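/- Let $\mu^{(k)}$, $k\in\mathbb N_0$, be finite Borel measures on $\mathbb R$, each supported on a bounded interval and none supported on a finite set. Let $p_l^{(k)}$ be the orthonormal polynomials of $\mu^{(k)}$ (degree $l$, positive leading coefficient), with recurrence $$x\,p_l^{(k)}(x)=b_{l+1}^{(k)}p_{l+1}^{(k)}(x)+a_l^{(k)}p_l^{(k)}(x)+b_l^{(k)}p_{l-1}^{(k)}(x),\qquad p_{-1}^{(k)}=0,\ b_0^{(k)}=0,$$ let $K_n^{(k)}(x,y)=\sum_{l=0}^n p_l^{(k)}(x)p_l^{(k)}(y)$, and let $x_{n,1}^{(k)}<\dots<x_{n,n}^{(k)}$ be the zeros of $p_n^{(k)}$. A regular Nörlund method $S$ is given by two non-negative sequences $(\sigma_n)$, $(\tau_n)$ through the weights $\sigma_{n,k}=\tau_n\sigma_{n-k}$ ($0\le k\le n$), where $\sum_{k=0}^n\sigma_{n,k}=1$ for all $n$ and $\lim_{n\to\infty}\sigma_{n,k}=0$ for every $k$. Put $N_n=\tau_n\sum_{k=0}^n 1/\tau_k$. For real numbers $\Sigma_{l_a,l_b}$ ($l_a,l_b\in\mathbb N_0$), the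 family $(\mu^{(k)})$ is in the mean Nevai class $M^{(S)}(\Sigma_{l_a,l_b})$ if (i) $\sup_{n,k}|a_n^{(k)}|<\infty$ and $\sup_{n,k}|b_n^{(k)}|<\infty$; (ii) $\lim_{n\to\infty}\sum_{k=0}^n\sigma_{n,k}|a_{k+l}^{(n-k)}-a_k^{(n-k)}|=0$ and $\lim_{n\to\infty}\sum_{k=0}^n\sigma_{n,k}|b_{k+l}^{(n-k)}-b_k^{(n-k)}|=0$ for all $l\in\mathbb N$; (iii) $\lim_{n\to\infty}\sum_{k=0}^n\sigma_{n,k}(a_k^{(n-k)})^{l_a}(b_k^{(n-k)})^{l_b}=\Sigma_{l_a,l_b}$ for all $l_a,l_b\in\mathbb N_0$. Define the measures $$d\bar\mu_n=\sum_{k=0}^n\sigma_{n,k}\bigl(p_k^{(n-k)}\bigr)^2d\mu^{(n-k)},\qquad d\lambda_n=\frac1{N_n}\sum_{k=0}^n\sigma_{n,k}K_k^{(n-k)}(x,x)\,d\mu^{(n-k)},\qquad \nu_{n+1}=\frac1{N_n}\sum_{k=0}^n\sigma_{n,k}\sum_{j=1}^{k+1}\delta_{x_{k+1,j}^{(n-k)}}.$$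 Theorem. Let $S$ be a regular Nörlund method with $N_n\to\infty$, and let the family $(\mu^{(k)})$ be in $M^{(S)}(\Sigma_{l_a,l_b})$. Then there is a compactly supported probability measure $\mu_\Sigma$ on $\mathbb R$ such that the probability measures $\nu_{n+1}$, $\lambda_n$ and $\bar\mu_n$ all converge weakly to $\mu_\Sigma$ as $n\to\infty$, and for every continuous $f:\mathbb R\to\mathbb R$ $$\lim_{n\to\infty}\frac1{N_n}\sum_{k=0}^n\sigma_{n,k}\sum_{j=1}^{k+1}f(x_{k+1,j}^{(n-k)})=\lim_{n\to\infty}\int f\,d\lambda_n=\lim_{n\to\infty}\int f\,d\bar\mu_n=\int f\,d\mu_\Sigma .$$ Moreover, $\mu_\Sigma$ is determined by the numbers $\Sigma_{l_a,l_b}$ with $l_b$ even: if $S'$ is any regular Nörlund method and $(\mu'^{(k)})$ any family of measures as above in $M^{(S')}(\Sigma'_{l_a,l_b})$ with $\Sigma'_{l_a,l_b}=\Sigma_{l_a,l_b}$ for all $l_a$ and all even $l_b$, then the corresponding measures $\bar\mu'_n$ also converge weakly to $\mu_\Sigma$. -/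

import Mathlib

open MeasureTheory Filter Topology Polynomial

noncomputable section

namespace MeanWeakLimits

/-! ### Orthonormal polynomials -/

/-- A finite Borel measure on `ℝ` that is supported on a bounded interval and is not
supported on a finite set, so that orthonormal polynomials of every degree exist. -/
structure IsAdmissible (μ : Measure ℝ) : Prop where
  finite : IsFiniteMeasure μ
  bounded : ∃ c d : ℝ, μ (Set.Icc c d)ᶜ = 0
  infinite : ∀ F : Finset ℝ, μ ((F : Set ℝ)ᶜ) ≠ 0

/-- The orthonormal polynomials `p_0, p_1, …` of `μ` (degree `n`, positive leading
coefficient), built by the Gram–Schmidt process from `1, X, X ^ 2, …`. -/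
def orthPoly (μ : Measure ℝ) (n : ℕ) : ℝ[X] :=
  let q : ℝ[X] := X ^ n - ∑ j : Fin n,
    C (∫ x, x ^ n * (orthPoly μ j.1).eval x ∂μ) * orthPoly μ j.1
  C (Real.sqrt (∫ x, (q.eval x) ^ 2 ∂μ))⁻¹ * q
termination_by n
decreasing_by all_goals exact j.2

/-- The coefficient `a_l` of `x p_l = b_{l+1} p_{l+1} + a_l p_l + b_l p_{l-1}`. -/
def recA (μ : Measure ℝ) (l : ℕ) : ℝ :=
  ∫ x, x * (orthPoly μ l).eval x ^ 2 ∂μ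

/-- The coefficient `b_l` of `x p_l = b_{l+1} p_{l+1} + a_l p_l + b_l p_{l-1}`,
with the convention `b_0 = 0`. -/
def recB (μ : Measure ℝ) : ℕ → ℝ
  | 0 => 0
  | l + 1 => ∫ x, x * (orthPoly μ l).eval x * (orthPoly μ (l + 1)).eval x ∂μ

/-- The Christoffel–Darboux kernel `K_n(x, y) = ∑_{l ≤ n} p_l(x) p_l(y)`. -/
def cdKernel (μ : Measure ℝ) (n : ℕ) (x y : ℝ) : ℝ :=
  ∑ l ∈ Finset.range (n + 1), (orthPoly μ l).eval x * (orthPoly μ l).eval y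

/-! ### Summation methods -/

/-- Regularity of the summation method `S_n(y) = ∑_{k ≤ n} w n k * y k` with non-negative
weights. Only the values `w n k` with `k ≤ n` matter. -/
structure IsRegular (w : ℕ → ℕ → ℝ) : Prop where
  nonneg : ∀ n k, k ≤ n → 0 ≤ w n k
  sum_eq_one : ∀ n, ∑ k ∈ Finset.range (n + 1), w n k = 1
  tendsto_zero : ∀ k, Tendsto (fun n => w n k) atTop (𝓝 0)

/-- The weights `σ_{n,k} = τ_n σ_{n-k}`, `k ≤ n`, of a Nörlund method. -/
def norlundWeight (σ τ : ℕ → ℝ) (n k : ℕ) : ℝ := τ n * σ (n - k)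

/-- The non-negative sequences `σ`, `τ` define a regular Nörlund method. -/
structure IsRegularNorlund (σ τ : ℕ → ℝ) : Prop where
  sigma_nonneg : ∀ n, 0 ≤ σ n
  tau_nonneg : ∀ n, 0 ≤ τ n
  regular : IsRegular (norlundWeight σ τ)

/-- The normalization constant `N_n = τ_n ∑_{k ≤ n} 1 / τ_k`. -/
def normConst (τ : ℕ → ℝ) (n : ℕ) : ℝ := τ n * ∑ k ∈ Finset.range (n + 1), 1 / τ k

/-! ### The mean Nevai class -/

/-- The family `μ 0, μ 1, …` lies in the mean Nevai class of the summation method with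
weights `w` and with limits `Sig la lb`. -/
structure MeanNevaiClass (w : ℕ → ℕ → ℝ) (Sig : ℕ → ℕ → ℝ) (μ : ℕ → Measure ℝ) : Prop where
  bounded_a : ∃ A : ℝ, ∀ n k, |recA (μ k) n| ≤ A
  bounded_b : ∃ B : ℝ, ∀ n k, |recB (μ k) n| ≤ B
  shift_a : ∀ l : ℕ, Tendsto (fun n => ∑ k ∈ Finset.range (n + 1),
    w n k * |recA (μ (n - k)) (k + l) - recA (μ (n - k)) k|) atTop (𝓝 0)
  shift_b : ∀ l : ℕ, Tendsto (fun n => ∑ k ∈ Finset.range (n + 1),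
    w n k * |recB (μ (n - k)) (k + l) - recB (μ (n - k)) k|) atTop (𝓝 0)
  moments : ∀ la lb : ℕ, Tendsto (fun n => ∑ k ∈ Finset.range (n + 1),
    w n k * (recA (μ (n - k)) k ^ la * recB (μ (n - k)) k ^ lb)) atTop (𝓝 (Sig la lb))

/-! ### The three sequences of mean measures -/

/-- `∑_{k ≤ n} σ_{n,k} (p_k^{(n-k)})² dμ^{(n-k)}`. -/
def meanMeasure (w : ℕ → ℕ → ℝ) (μ : ℕ → Measure ℝ) (n : ℕ) : Measure ℝ :=
  ∑ k ∈ Finset.range (n + 1), ENNReal.ofReal (w n k) •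
    (μ (n - k)).withDensity (fun x => ENNReal.ofReal ((orthPoly (μ (n - k)) k).eval x ^ 2))

/-- `λ_n = (1 / N_n) ∑_{k ≤ n} σ_{n,k} K_k^{(n-k)}(x, x) dμ^{(n-k)}`. -/
def cdMeasure (σ τ : ℕ → ℝ) (μ : ℕ → Measure ℝ) (n : ℕ) : Measure ℝ :=
  ENNReal.ofReal (1 / normConst τ n) • ∑ k ∈ Finset.range (n + 1),
    ENNReal.ofReal (norlundWeight σ τ n k) •
      (μ (n - k)).withDensity (fun x => ENNReal.ofReal (cdKernel (μ (n - k)) k x x))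

/-- `ν_{n+1} = (1 / N_n) ∑_{k ≤ n} σ_{n,k} ∑_j δ_{x_{k+1,j}^{(n-k)}}`, where
`x_{k+1,j}^{(n-k)}` runs through the zeros of `p_{k+1}^{(n-k)}`. -/
def zeroMeasure (σ τ : ℕ → ℝ) (μ : ℕ → Measure ℝ) (n : ℕ) : Measure ℝ :=
  ENNReal.ofReal (1 / normConst τ n) • ∑ k ∈ Finset.range (n + 1),
    ENNReal.ofReal (norlundWeight σ τ n k) •
      ((orthPoly (μ (n - k)) (k + 1)).roots.map (fun x => Measure.dirac x)).sum

/-- All `m n` are probability measures, and they converge weakly to `ρ`. -/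
def ConvergesWeakly (m : ℕ → Measure ℝ) (ρ : ProbabilityMeasure ℝ) : Prop :=
  ∃ m' : ℕ → ProbabilityMeasure ℝ,
    (∀ n, (m' n : Measure ℝ) = m n) ∧ Tendsto m' atTop (𝓝 ρ)

end MeanWeakLimits

end

/-!
Multiplication by `x` acts on the orthonormal polynomials of `μ` as the Jacobi matrix with diagonal
`a_l` and off-diagonal `b_l`, so moments of the three mean measures are weighted sums of entries of
powers of Jacobi matrices. With `|a_l| ≤ A` and `|b_l| ≤ B` these entries are at most
`(A + 2 B) ^ m`, which keeps all the measures inside the fixed interval `[-(A + 2 B), A + 2 B]`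
(`measure_compl_Icc_eq_zero_of_moments`). On a fixed compact interval, Prokhorov's theorem turns
convergent moments into a limit measure (`exists_limit_of_moments`), and Weierstrass approximation
turns convergence of moments into convergence of all integrals of continuous functions
(`tendsto_integral_of_moments`). It remains to find the limits of the moments.

* *Squared polynomials.* The integral of `x ^ m p_k ^ 2` involves only `a_l` and `b_l` with
  `|l - k| ≤ m`. In the weighted mean these may be replaced by `a_k` and `b_k`: for upward shifts
  this is the definition of the mean Nevai class, and for downward shifts it follows by passing from
  `(n, k)` to `(n - d, k - d)`, which keeps `n - k` and, `τ` being antitone, does not decrease the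
  weight (`MeanEq.shift_down`). What remains is the constant coefficient of `(b z + a + b / z) ^ m`
  at `a = a_k`, `b = b_k`, a polynomial that is even in `b`; its mean converges to a combination of
  the numbers `Sig la lb` with `lb` even (`exists_tendsto_matElem`).
* *Christoffel–Darboux kernels.* Summing along antidiagonals shows that `λ_n` is the average of the
  squared-polynomial means with weights `1 / τ_j`; since `∑ 1 / τ_j` diverges, the limit is the same
  (`cdMean_eq`, `tendsto_cdMean`).
* *Zeros.* The zeros of `p_{k+1}` are the eigenvalues of the truncated Jacobi matrix
  (`roots_orthPoly`), so their power sums are traces of its powers. The diagonal entries of these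
  powers are exact except in the last `m` rows, so the power sums differ from the moments of
  `K_k(x, x) dμ` by a bound independent of `k` (`abs_sum_roots_pow_sub_le`), and `N_n → ∞` removes
  the difference.
-/

noncomputable section

namespace MeanWeakLimits

/-! ### Orthonormality and the three-term recurrence -/

theorem integrable_of_measure_compl_Icc {μ : Measure ℝ} [IsFiniteMeasure μ] {c d : ℝ}
    (hcd : μ (Set.Icc c d)ᶜ = 0) {f : ℝ → ℝ} (hf : Continuous f) : Integrable f μ := by
  have h : μ.restrict (Set.Icc c d) = μ := Measure.restrict_eq_self_of_ae_mem hcd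
  have h2 : IntegrableOn f (Set.Icc c d) μ := hf.integrableOn_Icc
  rwa [IntegrableOn, h] at h2

theorem IsAdmissible.integrable {μ : Measure ℝ} (hμ : IsAdmissible μ) {f : ℝ → ℝ}
    (hf : Continuous f) : Integrable f μ := by
  obtain ⟨c, d, hcd⟩ := hμ.bounded
  have := hμ.finite
  exact integrable_of_measure_compl_Icc hcd hf

/-- Integration against an admissible measure as a linear functional on polynomials. -/
def intPoly {μ : Measure ℝ} (hμ : IsAdmissible μ) : ℝ[X] →ₗ[ℝ] ℝ where
  toFun p := ∫ x, p.eval x ∂μ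
  map_add' p q := by
    simp only [eval_add]
    exact integral_add (hμ.integrable p.continuous) (hμ.integrable q.continuous)
  map_smul' c p := by
    simp only [eval_smul, smul_eq_mul, RingHom.id_apply]
    exact integral_const_mul _ _

theorem intPoly_apply {μ : Measure ℝ} (hμ : IsAdmissible μ) (p : ℝ[X]) :
    intPoly hμ p = ∫ x, p.eval x ∂μ :=
  rfl

theorem intPoly_C_mul {μ : Measure ℝ} (hμ : IsAdmissible μ) (c : ℝ) (p : ℝ[X]) :
    intPoly hμ (C c * p) = c * intPoly hμ p := by
  rw [← smul_eq_C_mul, map_smul, smul_eq_mul]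

/-- A polynomial with zero norm would confine the measure to its finitely many roots. -/
theorem intPoly_sq_pos {μ : Measure ℝ} (hμ : IsAdmissible μ) {q : ℝ[X]} (hq : q ≠ 0) :
    0 < intPoly hμ (q * q) := by
  have h0 : 0 ≤ fun x => (q * q).eval x := fun x => by
    simp only [eval_mul, Pi.zero_apply]; exact mul_self_nonneg _
  rw [intPoly_apply, integral_pos_iff_support_of_nonneg h0 (hμ.integrable (q * q).continuous)]
  rw [pos_iff_ne_zero]
  convert hμ.infinite q.roots.toFinset using 2
  ext x
  simp [hq]

/-- The `n`-th step of the Gram–Schmidt process before normalization. -/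
def preOrth (μ : Measure ℝ) (n : ℕ) : ℝ[X] :=
  X ^ n - ∑ j : Fin n, C (∫ x, x ^ n * (orthPoly μ j.1).eval x ∂μ) * orthPoly μ j.1

theorem orthPoly_eq (μ : Measure ℝ) (n : ℕ) :
    orthPoly μ n = C (Real.sqrt (∫ x, ((preOrth μ n).eval x) ^ 2 ∂μ))⁻¹ * preOrth μ n := by
  rw [orthPoly, preOrth]

theorem orthPoly_eq_intPoly {μ : Measure ℝ} (hμ : IsAdmissible μ) (n : ℕ) :
    orthPoly μ n = C (Real.sqrt (intPoly hμ (preOrth μ n * preOrth μ n)))⁻¹ * preOrth μ n := by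
  rw [orthPoly_eq, intPoly_apply]
  simp only [eval_mul, pow_two]

theorem preOrth_eq_intPoly {μ : Measure ℝ} (hμ : IsAdmissible μ) (n : ℕ) :
    preOrth μ n =
      X ^ n - ∑ j : Fin n, C (intPoly hμ (X ^ n * orthPoly μ j.1)) * orthPoly μ j.1 := by
  simp only [preOrth, intPoly_apply, eval_mul, eval_pow, eval_X]

theorem preOrth_monic {μ : Measure ℝ} {n : ℕ} (ih : ∀ j < n, (orthPoly μ j).degree = j) :
    (preOrth μ n).Monic ∧ (preOrth μ n).degree = n := by
  have hlt : (∑ j : Fin n, C (∫ x, x ^ n * (orthPoly μ j.1).eval x ∂μ) * orthPoly μ j.1).degree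
      < (n : WithBot ℕ) := by
    refine (degree_sum_le _ _).trans_lt ((Finset.sup_lt_iff (WithBot.bot_lt_coe n)).2 ?_)
    intro j _
    rw [← smul_eq_C_mul]
    refine (degree_smul_le _ _).trans_lt ?_
    rw [ih j j.2]
    exact Nat.cast_lt.2 j.2
  refine ⟨monic_X_pow_sub ?_, ?_⟩
  · exact_mod_cast hlt
  · rw [preOrth, degree_sub_eq_left_of_degree_lt, degree_X_pow]
    rwa [degree_X_pow]

/-- The Gram–Schmidt induction: degree, normalization and orthogonality to all predecessors. -/
theorem orthPoly_gramSchmidt {μ : Measure ℝ} (hμ : IsAdmissible μ) (n : ℕ) :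
    (orthPoly μ n).degree = n ∧
    intPoly hμ (orthPoly μ n * orthPoly μ n) = 1 ∧
    ∀ i < n, intPoly hμ (orthPoly μ n * orthPoly μ i) = 0 := by
  induction n using Nat.strong_induction_on with
  | _ n ih =>
    obtain ⟨hm, hd⟩ := preOrth_monic (fun j hj => (ih j hj).1)
    have hpos := intPoly_sq_pos hμ hm.ne_zero
    set s := Real.sqrt (intPoly hμ (preOrth μ n * preOrth μ n)) with hs
    have hs0 : 0 < s := Real.sqrt_pos.2 hpos
    have hp := orthPoly_eq_intPoly hμ n
    rw [← hs] at hp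
    refine ⟨?_, ?_, ?_⟩
    · rw [hp, degree_C_mul (inv_ne_zero hs0.ne'), hd]
    · rw [hp, show C s⁻¹ * preOrth μ n * (C s⁻¹ * preOrth μ n)
        = C (s⁻¹ * s⁻¹) * (preOrth μ n * preOrth μ n) by rw [C_mul]; ring, intPoly_C_mul]
      have : s * s = intPoly hμ (preOrth μ n * preOrth μ n) := Real.mul_self_sqrt hpos.le
      rw [← this]
      field_simp
    · intro i hi
      rw [hp, mul_assoc, intPoly_C_mul, preOrth_eq_intPoly hμ, sub_mul, map_sub, Finset.sum_mul,
        map_sum, Finset.sum_eq_single (⟨i, hi⟩ : Fin n)]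
      · rw [mul_assoc, intPoly_C_mul, (ih i hi).2.1]
        simp
      · intro j _ hj
        rw [mul_assoc, intPoly_C_mul]
        have hji : j.1 ≠ i := fun h => hj (Fin.ext h)
        rcases lt_or_gt_of_ne hji with h | h
        · rw [mul_comm (orthPoly μ j.1), (ih i hi).2.2 j h, mul_zero]
        · rw [(ih j j.2).2.2 i h, mul_zero]
      · simp

theorem degree_orthPoly {μ : Measure ℝ} (hμ : IsAdmissible μ) (n : ℕ) :
    (orthPoly μ n).degree = n :=
  (orthPoly_gramSchmidt hμ n).1

theorem natDegree_orthPoly {μ : Measure ℝ} (hμ : IsAdmissible μ) (n : ℕ) :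
    (orthPoly μ n).natDegree = n :=
  natDegree_eq_of_degree_eq_some (degree_orthPoly hμ n)

theorem orthPoly_ne_zero {μ : Measure ℝ} (hμ : IsAdmissible μ) (n : ℕ) : orthPoly μ n ≠ 0 := by
  intro h
  have := degree_orthPoly hμ n
  simp [h] at this

theorem intPoly_orthPoly_mul {μ : Measure ℝ} (hμ : IsAdmissible μ) (i j : ℕ) :
    intPoly hμ (orthPoly μ i * orthPoly μ j) = if i = j then 1 else 0 := by
  rcases lt_trichotomy i j with h | h | h
  · rw [if_neg h.ne, mul_comm, (orthPoly_gramSchmidt hμ j).2.2 i h]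
  · rw [if_pos h, h, (orthPoly_gramSchmidt hμ j).2.1]
  · rw [if_neg h.ne', (orthPoly_gramSchmidt hμ i).2.2 j h]

theorem exists_sum_orthPoly {μ : Measure ℝ} (hμ : IsAdmissible μ) (N : ℕ) (q : ℝ[X])
    (hq : q.degree < N) :
    ∃ c : ℕ → ℝ, q = ∑ j ∈ Finset.range N, C (c j) * orthPoly μ j := by
  induction N generalizing q with
  | zero =>
    refine ⟨0, ?_⟩
    have : q = 0 := by
      rw [← degree_eq_bot]
      by_contra h
      have := zero_le_degree_iff.2 (fun h0 => h (degree_eq_bot.2 h0))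
      exact absurd hq (not_lt.2 (by simpa using this))
    simp [this]
  | succ N ih =>
    have hc : (orthPoly μ N).coeff N ≠ 0 := by
      have h := leadingCoeff_ne_zero.2 (orthPoly_ne_zero hμ N)
      rwa [leadingCoeff, natDegree_orthPoly hμ] at h
    set c0 := q.coeff N / (orthPoly μ N).coeff N with hc0
    have hd : (q - C c0 * orthPoly μ N).degree < N := by
      rw [degree_lt_iff_coeff_zero]
      intro m hm
      rcases hm.eq_or_lt with rfl | hm
      · simp [hc0, hc]
      · rw [coeff_sub, coeff_C_mul, coeff_eq_zero_of_degree_lt (hq.trans_le (by exact_mod_cast hm)),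
          coeff_eq_zero_of_degree_lt (p := orthPoly μ N)]
        · simp
        · rw [degree_orthPoly hμ]
          exact_mod_cast hm
    obtain ⟨c, hc⟩ := ih _ hd
    refine ⟨fun j => if j = N then c0 else c j, ?_⟩
    simp only [Finset.sum_range_succ, if_true]
    rw [← sub_eq_iff_eq_add, hc]
    refine Finset.sum_congr rfl fun j hj => ?_
    rw [if_neg (Finset.mem_range.1 hj).ne]

theorem eq_sum_orthPoly {μ : Measure ℝ} (hμ : IsAdmissible μ) (N : ℕ) (q : ℝ[X])
    (hq : q.degree < N) :
    q = ∑ j ∈ Finset.range N, C (intPoly hμ (q * orthPoly μ j)) * orthPoly μ j := by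
  obtain ⟨c, hc⟩ := exists_sum_orthPoly hμ N q hq
  conv_lhs => rw [hc]
  refine Finset.sum_congr rfl fun j hj => ?_
  congr 2
  rw [hc, Finset.sum_mul, map_sum, Finset.sum_eq_single j]
  · rw [mul_assoc, intPoly_C_mul, intPoly_orthPoly_mul]; simp
  · intro i _ hij
    rw [mul_assoc, intPoly_C_mul, intPoly_orthPoly_mul]; simp [hij]
  · intro h; exact absurd hj h

theorem intPoly_orthPoly_mul_of_degree_lt {μ : Measure ℝ} (hμ : IsAdmissible μ) (n : ℕ)
    (q : ℝ[X]) (hq : q.degree < n) :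
    intPoly hμ (orthPoly μ n * q) = 0 := by
  rw [eq_sum_orthPoly hμ n q hq, Finset.mul_sum, map_sum]
  refine Finset.sum_eq_zero fun j hj => ?_
  rw [mul_left_comm, intPoly_C_mul, intPoly_orthPoly_mul, if_neg (Finset.mem_range.1 hj).ne',
    mul_zero]

theorem recA_eq {μ : Measure ℝ} (hμ : IsAdmissible μ) (l : ℕ) :
    recA μ l = intPoly hμ (X * orthPoly μ l * orthPoly μ l) := by
  simp only [recA, intPoly_apply, eval_mul, eval_X, pow_two, mul_assoc]

theorem recB_succ_eq {μ : Measure ℝ} (hμ : IsAdmissible μ) (l : ℕ) :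
    recB μ (l + 1) = intPoly hμ (X * orthPoly μ l * orthPoly μ (l + 1)) := by
  simp only [recB, intPoly_apply, eval_mul, eval_X]

/-- Extension of a sequence to the integers by zero at negative indices. -/
def zext {M : Type*} [Zero M] (u : ℕ → M) : ℤ → M
  | .ofNat n => u n
  | .negSucc _ => 0

@[simp] theorem zext_natCast {M : Type*} [Zero M] (u : ℕ → M) (n : ℕ) : zext u (n : ℤ) = u n := rfl

theorem zext_of_neg {M : Type*} [Zero M] (u : ℕ → M) {l : ℤ} (h : l < 0) : zext u l = 0 := by
  cases l with
  | ofNat n => simp at h; omega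
  | negSucc n => rfl

/-- The three-term recurrence. With the convention `p_l = 0` for `l < 0` it holds at every
integer index, because `b_0 = 0`. -/
theorem X_mul_orthPoly {μ : Measure ℝ} (hμ : IsAdmissible μ) (l : ℤ) : X * zext (orthPoly μ) l =
    C (zext (recB μ) (l + 1)) * zext (orthPoly μ) (l + 1) +
      C (zext (recA μ) l) * zext (orthPoly μ) l +
      C (zext (recB μ) l) * zext (orthPoly μ) (l - 1) := by
  rcases lt_or_ge l 0 with h | h
  · rw [zext_of_neg _ h, zext_of_neg _ (show l - 1 < 0 by omega)]
    rcases eq_or_lt_of_le (show l + 1 ≤ 0 by omega) with h1 | h1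
    · rw [h1]
      have : zext (recB μ) 0 = 0 := rfl
      simp [this]
    · simp [zext_of_neg _ h1]
  · lift l to ℕ using h
    have hd : (X * orthPoly μ l).degree < ((l + 2 : ℕ) : WithBot ℕ) := by
      rw [degree_mul, degree_X, degree_orthPoly hμ]
      norm_cast
      omega
    have hz : ∀ j, j + 1 < l → intPoly hμ (X * orthPoly μ l * orthPoly μ j) = 0 := by
      intro j hj
      rw [show X * orthPoly μ l * orthPoly μ j = orthPoly μ l * (X * orthPoly μ j) by ring]
      apply intPoly_orthPoly_mul_of_degree_lt
      rw [degree_mul, degree_X, degree_orthPoly hμ]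
      norm_cast
      omega
    have e := eq_sum_orthPoly hμ (l + 2) _ hd
    rw [Finset.sum_range_succ, Finset.sum_range_succ, ← recA_eq, ← recB_succ_eq] at e
    rw [show ((l : ℤ) + 1) = ((l + 1 : ℕ) : ℤ) by push_cast; ring]
    simp only [zext_natCast]
    cases l with
    | zero =>
      rw [e]
      simp [recB]
      ring
    | succ m =>
      rw [show (((m + 1 : ℕ) : ℤ) - 1) = (m : ℤ) by push_cast; ring]
      rw [Finset.sum_range_succ, Finset.sum_eq_zero] at e
      · rw [show X * orthPoly μ (m + 1) * orthPoly μ m = X * orthPoly μ m * orthPoly μ (m + 1) by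
          ring, ← recB_succ_eq] at e
        rw [e]
        simp only [zext_natCast]
        ring
      · intro j hj
        rw [hz j (by have := Finset.mem_range.1 hj; omega)]
        simp

/-! ### Matrix elements of multiplication by powers of `x` -/

/-- The matrix element `∫ x ^ m p_i p_j dμ` of multiplication by `x ^ m`; it vanishes when `i` or
`j` is negative. -/
def matElem {μ : Measure ℝ} (hμ : IsAdmissible μ) (m : ℕ) (i j : ℤ) : ℝ :=
  intPoly hμ (X ^ m * zext (orthPoly μ) i * zext (orthPoly μ) j)

theorem matElem_zero {μ : Measure ℝ} (hμ : IsAdmissible μ) (i j : ℕ) :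
    matElem hμ 0 i j = if i = j then 1 else 0 := by
  simp [matElem, intPoly_orthPoly_mul]

theorem matElem_succ {μ : Measure ℝ} (hμ : IsAdmissible μ) (m : ℕ) (i j : ℤ) :
    matElem hμ (m + 1) i j = zext (recB μ) (j + 1) * matElem hμ m i (j + 1) +
      zext (recA μ) j * matElem hμ m i j + zext (recB μ) j * matElem hμ m i (j - 1) := by
  simp only [matElem]
  rw [show X ^ (m + 1) * zext (orthPoly μ) i * zext (orthPoly μ) j =
    X ^ m * zext (orthPoly μ) i * (X * zext (orthPoly μ) j) by ring, X_mul_orthPoly hμ,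
    mul_add, mul_add, map_add, map_add]
  simp only [← intPoly_C_mul]
  congr 1
  · congr 1 <;> congr 1 <;> ring
  · congr 1; ring

theorem abs_zext_le {u : ℕ → ℝ} {A : ℝ} (h : ∀ n, |u n| ≤ A) (l : ℤ) : |zext u l| ≤ A := by
  cases l with
  | ofNat n => exact h n
  | negSucc n => simpa [zext] using (abs_nonneg _).trans (h 0)

theorem abs_matElem_le {μ : Measure ℝ} (hμ : IsAdmissible μ) {A B : ℝ} (hA : ∀ n, |recA μ n| ≤ A)
    (hB : ∀ n, |recB μ n| ≤ B) (m : ℕ) (i j : ℤ) : |matElem hμ m i j| ≤ (A + 2 * B) ^ m := by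
  have hA0 : 0 ≤ A := (abs_nonneg _).trans (hA 0)
  have hB0 : 0 ≤ B := (abs_nonneg _).trans (hB 0)
  induction m generalizing j with
  | zero =>
    rcases lt_or_ge i 0 with hi | hi
    · simp [matElem, zext_of_neg _ hi]
    rcases lt_or_ge j 0 with hj | hj
    · simp [matElem, zext_of_neg _ hj]
    lift i to ℕ using hi
    lift j to ℕ using hj
    rw [matElem_zero]
    split_ifs <;> simp
  | succ m ih =>
    rw [matElem_succ]
    have key : ∀ {s t c C : ℝ}, |s| ≤ c → |t| ≤ C → 0 ≤ c → |s * t| ≤ c * C := fun h1 h2 h0 => by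
      rw [abs_mul]; exact mul_le_mul h1 h2 (abs_nonneg _) h0
    have h1 := key (abs_zext_le hB (j + 1)) (ih (j + 1)) hB0
    have h2 := key (abs_zext_le hA j) (ih j) hA0
    have h3 := key (abs_zext_le hB j) (ih (j - 1)) hB0
    refine (abs_add_three _ _ _).trans ?_
    rw [pow_succ]
    linarith

/-! ### Truncated Jacobi matrices and the zeros of orthogonal polynomials -/

/-- The truncated Jacobi matrix of size `N`, with diagonal `a_0, …, a_{N-1}` and off-diagonal
`b_1, …, b_{N-1}`. -/
def jacobi (μ : Measure ℝ) (N : ℕ) : Matrix (Fin N) (Fin N) ℝ :=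
  Matrix.of fun i j => (if i.1 = j.1 then recA μ i.1 else 0) +
    (if i.1 = j.1 + 1 then recB μ i.1 else 0) + (if j.1 = i.1 + 1 then recB μ j.1 else 0)

theorem jacobi_isHermitian (μ : Measure ℝ) (N : ℕ) : (jacobi μ N).IsHermitian := by
  ext i j
  simp only [jacobi, Matrix.conjTranspose_apply, Matrix.of_apply, star_trivial]
  by_cases h : i.1 = j.1
  · simp [h]
  · simp [h, Ne.symm h]
    ring

theorem sum_fin_ite {M : Type*} [AddCommMonoid M] (N k : ℕ) (g : ℕ → M) :
    ∑ i : Fin N, (if i.1 = k then g i.1 else 0) = if k < N then g k else 0 := by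
  rw [Fin.sum_univ_eq_sum_range (fun i => if i = k then g i else 0) N, Finset.sum_ite_eq']
  simp

theorem sum_fin_ite_succ {M : Type*} [AddCommMonoid M] {N k : ℕ} (hk : k < N) (g : ℕ → M) :
    ∑ i : Fin N, (if k = i.1 + 1 then g i.1 else 0) = if k = 0 then 0 else g (k - 1) := by
  cases k with
  | zero => simp
  | succ k =>
    simp only [add_left_inj, eq_comm (a := k)]
    rw [sum_fin_ite, if_pos (by omega)]
    simp

/-- Multiplication by `x` in terms of the truncated Jacobi matrix: the truncation is felt only at
the last index. -/
theorem X_mul_orthPoly_eq_jacobi {μ : Measure ℝ} (hμ : IsAdmissible μ) {N : ℕ} (j : Fin N) :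
    X * orthPoly μ j = ∑ i : Fin N, C (jacobi μ N i j) * orthPoly μ i +
      if j.1 + 1 = N then C (recB μ N) * orthPoly μ N else 0 := by
  have h := X_mul_orthPoly hμ (j.1 : ℤ)
  have e1 : ∑ i : Fin N, C (jacobi μ N i j) * orthPoly μ i =
      (∑ i : Fin N, if i.1 = j.1 then C (recA μ i.1) * orthPoly μ i.1 else 0) +
      (∑ i : Fin N, if i.1 = j.1 + 1 then C (recB μ i.1) * orthPoly μ i.1 else 0) +
      (∑ i : Fin N, if j.1 = i.1 + 1 then C (recB μ j.1) * orthPoly μ i.1 else 0) := by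
    rw [← Finset.sum_add_distrib, ← Finset.sum_add_distrib]
    refine Finset.sum_congr rfl fun i _ => ?_
    simp only [jacobi, Matrix.of_apply, C_add, add_mul]
    congr 1
    · congr 1 <;> split_ifs <;> simp
    · split_ifs <;> simp
  rw [e1, sum_fin_ite N j.1 (fun i => C (recA μ i) * orthPoly μ i),
    sum_fin_ite N (j.1 + 1) (fun i => C (recB μ i) * orthPoly μ i),
    sum_fin_ite_succ j.2 (fun i => C (recB μ j.1) * orthPoly μ i), if_pos j.2]
  rw [show ((j.1 : ℤ) + 1) = ((j.1 + 1 : ℕ) : ℤ) by push_cast; ring] at h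
  simp only [zext_natCast] at h
  have e2 : C (recB μ j.1) * zext (orthPoly μ) ((j.1 : ℤ) - 1) =
      if j.1 = 0 then 0 else C (recB μ j.1) * orthPoly μ (j.1 - 1) := by
    split_ifs with h0
    · rw [zext_of_neg _ (by omega), mul_zero]
    · rw [show ((j.1 : ℤ) - 1) = ((j.1 - 1 : ℕ) : ℤ) by omega, zext_natCast]
  rw [h, e2]
  have hj := j.2
  by_cases hN : j.1 + 1 = N
  · simp only [hN, lt_irrefl, if_false, if_true]
    ring
  · rw [if_pos (show j.1 + 1 < N by omega), if_neg hN]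
    ring

theorem sum_abs_jacobi_le {μ : Measure ℝ} {A B : ℝ} (hA : ∀ n, |recA μ n| ≤ A)
    (hB : ∀ n, |recB μ n| ≤ B) {N : ℕ} (j : Fin N) : ∑ i, |jacobi μ N i j| ≤ A + 2 * B := by
  have hB0 : 0 ≤ B := (abs_nonneg _).trans (hB 0)
  have h1 : ∀ i : Fin N, |jacobi μ N i j| ≤ (if i.1 = j.1 then |recA μ i.1| else 0) +
      (if i.1 = j.1 + 1 then |recB μ i.1| else 0) +
      (if j.1 = i.1 + 1 then |recB μ j.1| else 0) := by
    intro i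
    refine (abs_add_three _ _ _).trans (le_of_eq ?_)
    congr 1
    · congr 1 <;> split_ifs <;> simp
    · split_ifs <;> simp
  refine (Finset.sum_le_sum fun i _ => h1 i).trans ?_
  rw [Finset.sum_add_distrib, Finset.sum_add_distrib, sum_fin_ite N j.1 (fun i => |recA μ i|),
    sum_fin_ite N (j.1 + 1) (fun i => |recB μ i|), sum_fin_ite_succ j.2 (fun _ => |recB μ j.1|),
    if_pos j.2]
  have h2 := hA j.1
  have h3 : (if j.1 + 1 < N then |recB μ (j.1 + 1)| else 0) ≤ B := by
    split_ifs; exacts [hB _, hB0]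
  have h4 : (if j.1 = 0 then 0 else |recB μ j.1|) ≤ B := by
    split_ifs; exacts [hB0, hB _]
  linarith

theorem abs_jacobi_pow_le {μ : Measure ℝ} {A B : ℝ} (hA : ∀ n, |recA μ n| ≤ A)
    (hB : ∀ n, |recB μ n| ≤ B) {N : ℕ} (m : ℕ) (i j : Fin N) :
    |(jacobi μ N ^ m) i j| ≤ (A + 2 * B) ^ m := by
  have hA0 : 0 ≤ A := (abs_nonneg _).trans (hA 0)
  have hB0 : 0 ≤ B := (abs_nonneg _).trans (hB 0)
  induction m generalizing j with
  | zero =>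
    rw [pow_zero, Matrix.one_apply]
    split_ifs <;> simp
  | succ m ih =>
    rw [pow_succ, Matrix.mul_apply, pow_succ]
    calc |∑ l, (jacobi μ N ^ m) i l * jacobi μ N l j|
        ≤ ∑ l, |(jacobi μ N ^ m) i l * jacobi μ N l j| := Finset.abs_sum_le_sum_abs _ _
      _ ≤ ∑ l, (A + 2 * B) ^ m * |jacobi μ N l j| := Finset.sum_le_sum fun l _ => by
          rw [abs_mul]; exact mul_le_mul_of_nonneg_right (ih l) (abs_nonneg _)
      _ = (A + 2 * B) ^ m * ∑ l, |jacobi μ N l j| := by rw [Finset.mul_sum]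
      _ ≤ _ := mul_le_mul_of_nonneg_left (sum_abs_jacobi_le hA hB j) (by positivity)

/-- Away from the lower right corner the powers of the truncated Jacobi matrix are exact. -/
theorem jacobi_pow_apply {μ : Measure ℝ} (hμ : IsAdmissible μ) {N : ℕ} (m : ℕ) (i j : Fin N)
    (him : i.1 + m ≤ N) : (jacobi μ N ^ m) i j = matElem hμ m i.1 j.1 := by
  induction m generalizing j with
  | zero =>
    rw [matElem_zero, pow_zero, Matrix.one_apply]
    simp only [Fin.ext_iff]
  | succ m ih =>
    rw [pow_succ, Matrix.mul_apply]
    have h : matElem hμ (m + 1) i.1 j.1 =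
        intPoly hμ (X ^ m * orthPoly μ i.1 * (X * orthPoly μ j.1)) := by
      simp only [matElem, zext_natCast]
      congr 1; ring
    rw [h, X_mul_orthPoly_eq_jacobi hμ, mul_add, map_add, Finset.mul_sum, map_sum]
    have h0 : intPoly hμ (X ^ m * orthPoly μ i.1 *
        if j.1 + 1 = N then C (recB μ N) * orthPoly μ N else 0) = 0 := by
      split_ifs
      · rw [mul_left_comm, intPoly_C_mul, mul_comm _ (orthPoly μ N),
          intPoly_orthPoly_mul_of_degree_lt, mul_zero]
        rw [degree_mul, degree_X_pow, degree_orthPoly hμ]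
        norm_cast
        omega
      · simp
    rw [h0, add_zero]
    refine Finset.sum_congr rfl fun l _ => ?_
    rw [mul_left_comm, intPoly_C_mul, ih l (by omega), mul_comm]
    simp only [matElem, zext_natCast]

/-- The zeros of `p_N` are the eigenvalues of the truncated Jacobi matrix. Writing `v` for the
vector `(p_0, …, p_{N-1})`, the recurrence says `(X - J) v = b_N p_N e_{N-1}`; multiplying by the
adjugate shows that `p_N` divides the characteristic polynomial, which has the same degree. -/
theorem roots_orthPoly {μ : Measure ℝ} (hμ : IsAdmissible μ) (n : ℕ) :
    (orthPoly μ (n + 1)).roots = (jacobi μ (n + 1)).charpoly.roots := by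
  set J := jacobi μ (n + 1) with hJ
  set v : Fin (n + 1) → ℝ[X] := fun i => orthPoly μ i.1 with hv
  have hmul : Matrix.vecMul v J.charmatrix =
      fun j => if j.1 + 1 = n + 1 then C (recB μ (n + 1)) * orthPoly μ (n + 1) else 0 := by
    ext1 j
    have h := X_mul_orthPoly_eq_jacobi hμ j
    rw [Matrix.vecMul, dotProduct]
    simp only [Matrix.charmatrix_apply, mul_sub, Finset.sum_sub_distrib, Matrix.diagonal_apply,
      mul_ite, mul_zero, Finset.sum_ite_eq', Finset.mem_univ, if_true]
    rw [sub_eq_iff_eq_add', hv]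
    simp only
    rw [mul_comm, h]
    congr 1
    exact Finset.sum_congr rfl fun i _ => mul_comm _ _
  have hdvd : orthPoly μ (n + 1) ∣ J.charpoly := by
    have h1 := congrArg (fun w => Matrix.vecMul w J.charmatrix.adjugate) hmul
    simp only [Matrix.vecMul_vecMul, Matrix.mul_adjugate] at h1
    have h2 := congrFun h1 0
    rw [Matrix.vecMul_smul, Matrix.vecMul_one] at h2
    have h3 : orthPoly μ (n + 1) ∣ J.charmatrix.det * orthPoly μ 0 := by
      have h4 : J.charmatrix.det * orthPoly μ 0 = (J.charmatrix.det • v) 0 := rfl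
      rw [h4, h2, Matrix.vecMul, dotProduct]
      refine Finset.dvd_sum fun j _ => Dvd.dvd.mul_right ?_ _
      split_ifs
      · exact Dvd.intro_left _ rfl
      · exact dvd_zero _
    have hu : IsUnit (orthPoly μ 0) := by
      rw [Polynomial.isUnit_iff_degree_eq_zero, degree_orthPoly hμ]; rfl
    exact (hu.dvd_mul_right).1 h3
  have hne : J.charpoly ≠ 0 := (Matrix.charpoly_monic J).ne_zero
  obtain ⟨q, hq⟩ := hdvd
  have hq0 : q ≠ 0 := by rintro rfl; simp [hq] at hne
  have hdeg : q.natDegree = 0 := by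
    have h1 := congrArg natDegree hq
    rw [natDegree_mul (orthPoly_ne_zero hμ _) hq0, natDegree_orthPoly hμ,
      Matrix.charpoly_natDegree_eq_dim, Fintype.card_fin] at h1
    omega
  rw [hq, roots_mul (hq ▸ hne), show q.roots = 0 by rw [eq_C_of_natDegree_eq_zero hdeg, roots_C],
    add_zero]

theorem card_roots_orthPoly {μ : Measure ℝ} (hμ : IsAdmissible μ) (n : ℕ) :
    Multiset.card (orthPoly μ (n + 1)).roots = n + 1 := by
  rw [roots_orthPoly hμ, (jacobi_isHermitian μ (n + 1)).roots_charpoly_eq_eigenvalues]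
  simp

theorem sum_roots_pow {μ : Measure ℝ} (hμ : IsAdmissible μ) (n m : ℕ) :
    ((orthPoly μ (n + 1)).roots.map (fun x => x ^ m)).sum = (jacobi μ (n + 1) ^ m).trace := by
  have hJ := jacobi_isHermitian μ (n + 1)
  rw [roots_orthPoly hμ, hJ.roots_charpoly_eq_eigenvalues]
  conv_rhs => rw [hJ.spectral_theorem, ← map_pow, Unitary.conjStarAlgAut_apply,
    Matrix.trace_mul_cycle, Unitary.coe_star_mul_self, one_mul, Matrix.diagonal_pow, Matrix.trace_diagonal]
  rw [Multiset.map_map]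
  exact Finset.sum_congr rfl fun i _ => by simp

/-- The power sums of the zeros of `p_{k+1}` differ from the moments of `K_k(x, x) dμ` by a bound
that does not depend on `k`. -/
theorem abs_sum_roots_pow_sub_le {μ : Measure ℝ} (hμ : IsAdmissible μ) {A B : ℝ}
    (hA : ∀ n, |recA μ n| ≤ A) (hB : ∀ n, |recB μ n| ≤ B) (k m : ℕ) :
    |((orthPoly μ (k + 1)).roots.map (fun x => x ^ m)).sum -
      ∑ l ∈ Finset.range (k + 1), matElem hμ m l l| ≤ m * (2 * (A + 2 * B) ^ m) := by
  have hA0 : 0 ≤ A := (abs_nonneg _).trans (hA 0)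
  have hB0 : 0 ≤ B := (abs_nonneg _).trans (hB 0)
  rw [sum_roots_pow hμ, Matrix.trace, ← Fin.sum_univ_eq_sum_range (fun l => matElem hμ m l l),
    ← Finset.sum_sub_distrib]
  refine (Finset.abs_sum_le_sum_abs _ _).trans ?_
  have h1 : ∀ i : Fin (k + 1), |(jacobi μ (k + 1) ^ m).diag i - matElem hμ m i.1 i.1| ≤
      if k + 1 < i.1 + m then 2 * (A + 2 * B) ^ m else 0 := by
    intro i
    rw [Matrix.diag_apply]
    split_ifs with h
    · refine (abs_sub _ _).trans ?_
      linarith [abs_jacobi_pow_le hA hB m i i, abs_matElem_le hμ hA hB m i.1 i.1]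
    · rw [jacobi_pow_apply hμ m i i (not_lt.1 h), sub_self, abs_zero]
  refine (Finset.sum_le_sum fun i _ => h1 i).trans ?_
  rw [Fin.sum_univ_eq_sum_range (fun i => if k + 1 < i + m then 2 * (A + 2 * B) ^ m else 0),
    ← Finset.sum_filter, Finset.sum_const, nsmul_eq_mul]
  refine mul_le_mul_of_nonneg_right ?_ (by positivity)
  have h2 : (Finset.range (k + 1)).filter (fun i => k + 1 < i + m) ⊆
      Finset.Ico (k + 2 - m) (k + 1) := by
    intro i hi
    simp only [Finset.mem_filter, Finset.mem_range, Finset.mem_Ico] at hi ⊢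
    omega
  have h3 := Finset.card_le_card h2
  rw [Nat.card_Ico] at h3
  exact_mod_cast h3.trans (by omega)

theorem sum_roots_pow_le {μ : Measure ℝ} (hμ : IsAdmissible μ) {A B : ℝ}
    (hA : ∀ n, |recA μ n| ≤ A) (hB : ∀ n, |recB μ n| ≤ B) (k m : ℕ) :
    ((orthPoly μ (k + 1)).roots.map (fun x => x ^ m)).sum ≤ (k + 1) * (A + 2 * B) ^ m := by
  rw [sum_roots_pow hμ, Matrix.trace]
  refine (Finset.sum_le_sum fun i _ => (le_abs_self _).trans
    (abs_jacobi_pow_le hA hB m i i)).trans ?_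
  simp

/-! ### Equality in the mean -/

/-- The arrays `u k j` and `v k j` (`k` is the degree, `j` the index of the measure) agree in the
mean: the weighted means of `|u - v|` along the antidiagonals `k + j = n` tend to zero. -/
def MeanEq (w : ℕ → ℕ → ℝ) (u v : ℕ → ℕ → ℝ) : Prop :=
  Tendsto (fun n => ∑ k ∈ Finset.range (n + 1), w n k * |u k (n - k) - v k (n - k)|) atTop (𝓝 0)

theorem MeanEq.of_le {w : ℕ → ℕ → ℝ} (hw : IsRegular w) {u v u' v' : ℕ → ℕ → ℝ} {C : ℝ}
    (h : MeanEq w u v) (hle : ∀ k j, |u' k j - v' k j| ≤ C * |u k j - v k j|) :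
    MeanEq w u' v' := by
  have h1 := h.const_mul C
  rw [mul_zero] at h1
  refine squeeze_zero (fun n => Finset.sum_nonneg fun k hk => ?_) (fun n => ?_) h1
  · exact mul_nonneg (hw.nonneg n k (by simp at hk; omega)) (abs_nonneg _)
  · rw [Finset.mul_sum]
    refine Finset.sum_le_sum fun k hk => ?_
    rw [mul_left_comm]
    exact mul_le_mul_of_nonneg_left (hle _ _) (hw.nonneg n k (by simp at hk; omega))

theorem MeanEq.add {w : ℕ → ℕ → ℝ} (hw : IsRegular w) {u v u' v' : ℕ → ℕ → ℝ}
    (h : MeanEq w u v) (h' : MeanEq w u' v') :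
    MeanEq w (fun k j => u k j + u' k j) (fun k j => v k j + v' k j) := by
  have h1 := Tendsto.add h h'
  rw [add_zero] at h1
  refine squeeze_zero (fun n => Finset.sum_nonneg fun k hk => ?_) (fun n => ?_) h1
  · exact mul_nonneg (hw.nonneg n k (by simp at hk; omega)) (abs_nonneg _)
  · rw [← Finset.sum_add_distrib]
    refine Finset.sum_le_sum fun k hk => ?_
    rw [← mul_add]
    refine mul_le_mul_of_nonneg_left ?_ (hw.nonneg n k (by simp at hk; omega))
    rw [add_sub_add_comm]
    exact abs_add_le _ _

theorem MeanEq.mul {w : ℕ → ℕ → ℝ} (hw : IsRegular w) {u v u' v' : ℕ → ℕ → ℝ} {C C' : ℝ}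
    (h : MeanEq w u v) (h' : MeanEq w u' v') (hC : ∀ k j, |v k j| ≤ C)
    (hC' : ∀ k j, |u' k j| ≤ C') :
    MeanEq w (fun k j => u k j * u' k j) (fun k j => v k j * v' k j) := by
  have h1 : MeanEq w (fun k j => (u k j - v k j) * u' k j) (fun _ _ => 0) := by
    refine h.of_le hw (C := C') fun k j => ?_
    rw [sub_zero, abs_mul, mul_comm]
    exact mul_le_mul_of_nonneg_right (hC' k j) (abs_nonneg _)
  have h2 : MeanEq w (fun k j => v k j * (u' k j - v' k j)) (fun _ _ => 0) := by
    refine h'.of_le hw (C := C) fun k j => ?_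
    rw [sub_zero, abs_mul]
    exact mul_le_mul_of_nonneg_right (hC k j) (abs_nonneg _)
  refine (h1.add hw h2).of_le hw (C := 1) fun k j => le_of_eq ?_
  rw [one_mul]
  congr 1
  ring

theorem MeanEq.refl (w u) : MeanEq w u u := by
  simp [MeanEq]

theorem MeanEq.tendsto {w : ℕ → ℕ → ℝ} (hw : IsRegular w) {u v : ℕ → ℕ → ℝ} (h : MeanEq w u v)
    {L : ℝ} (hv : Tendsto (fun n => ∑ k ∈ Finset.range (n + 1), w n k * v k (n - k)) atTop (𝓝 L)) :
    Tendsto (fun n => ∑ k ∈ Finset.range (n + 1), w n k * u k (n - k)) atTop (𝓝 L) := by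
  have h1 : Tendsto (fun n => ∑ k ∈ Finset.range (n + 1), w n k * (u k (n - k) - v k (n - k)))
      atTop (𝓝 0) := by
    refine squeeze_zero_norm (fun n => ?_) h
    rw [Real.norm_eq_abs]
    refine (Finset.abs_sum_le_sum_abs _ _).trans (Finset.sum_le_sum fun k hk => ?_)
    rw [abs_mul, abs_of_nonneg (hw.nonneg n k (by simp at hk; omega))]
  have h2 := h1.add hv
  rw [zero_add] at h2
  refine h2.congr fun n => ?_
  rw [← Finset.sum_add_distrib]
  exact Finset.sum_congr rfl fun k _ => by ring

/-! ### Nörlund weights -/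

theorem one_div_tau {σ τ : ℕ → ℝ} (hS : IsRegularNorlund σ τ) (n : ℕ) :
    1 / τ n = ∑ k ∈ Finset.range (n + 1), σ k := by
  have h := hS.regular.sum_eq_one n
  simp only [norlundWeight] at h
  rw [← Finset.mul_sum, ← Finset.sum_range_reflect] at h
  have h2 : ∑ k ∈ Finset.range (n + 1), σ (n - (n + 1 - 1 - k)) =
      ∑ k ∈ Finset.range (n + 1), σ k :=
    Finset.sum_congr rfl fun k hk => by
      have := Finset.mem_range.1 hk
      congr 1; omega
  rw [h2] at h
  exact (eq_one_div_of_mul_eq_one_right h).symm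

theorem tau_pos {σ τ : ℕ → ℝ} (hS : IsRegularNorlund σ τ) (n : ℕ) : 0 < τ n := by
  refine lt_of_le_of_ne (hS.tau_nonneg n) fun h => ?_
  have h1 := hS.regular.sum_eq_one n
  simp [norlundWeight, ← h] at h1

theorem tau_antitone {σ τ : ℕ → ℝ} (hS : IsRegularNorlund σ τ) : Antitone τ := by
  intro m n hmn
  rw [← one_div_le_one_div (tau_pos hS m) (tau_pos hS n), one_div_tau hS, one_div_tau hS]
  exact Finset.sum_le_sum_of_subset_of_nonneg (Finset.range_subset_range.2 (by omega))
    fun i _ _ => hS.sigma_nonneg i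

/-- For Nörlund weights a downward shift of the degree is as harmless as an upward one: passing
from `(n, k)` to `(n - d, k - d)` keeps the measure index `n - k` and does not decrease the
weight, because `τ` is antitone. -/
theorem MeanEq.shift_down {σ τ : ℕ → ℝ} (hS : IsRegularNorlund σ τ) {u : ℕ → ℕ → ℝ} {C : ℝ}
    (hC : ∀ k j, |u k j| ≤ C) (d : ℕ)
    (h : MeanEq (norlundWeight σ τ) (fun k j => u (k + d) j) u) :
    MeanEq (norlundWeight σ τ) (fun k j => if k < d then 0 else u (k - d) j) u := by
  have hC0 : 0 ≤ C := (abs_nonneg _).trans (hC 0 0)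
  have hw := hS.regular
  -- the finitely many degrees `k < d`
  have h1 : Tendsto (fun n => ∑ k ∈ Finset.range d, norlundWeight σ τ n k * C) atTop (𝓝 0) := by
    have := tendsto_finsetSum (Finset.range d)
      fun k _ => (hw.tendsto_zero k).mul_const C
    simpa using this
  have h2 : Tendsto (fun n => ∑ k ∈ Finset.range (n - d + 1), norlundWeight σ τ (n - d) k *
      |u (k + d) (n - d - k) - u k (n - d - k)|) atTop (𝓝 0) :=
    h.comp (tendsto_sub_atTop_nat d)
  have h3 := h1.add h2
  rw [add_zero] at h3
  refine squeeze_zero' (Eventually.of_forall fun n => Finset.sum_nonneg fun k hk => ?_) ?_ h3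
  · exact mul_nonneg (hw.nonneg n k (by simp at hk; omega)) (abs_nonneg _)
  filter_upwards [eventually_ge_atTop d] with n hn
  rw [show n + 1 = d + (n - d + 1) by omega, Finset.sum_range_add]
  refine add_le_add (Finset.sum_le_sum fun k hk => ?_) (Finset.sum_le_sum fun k hk => ?_)
  · have hk := Finset.mem_range.1 hk
    rw [if_pos hk, zero_sub, abs_neg]
    exact mul_le_mul_of_nonneg_left (hC _ _) (hw.nonneg n k (by omega))
  · have hk := Finset.mem_range.1 hk
    rw [if_neg (by omega), abs_sub_comm, show d + k - d = k by omega, add_comm d k,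
      show n - (k + d) = n - d - k by omega]
    refine mul_le_mul_of_nonneg_right ?_ (abs_nonneg _)
    rw [norlundWeight, norlundWeight, show n - (k + d) = n - d - k by omega]
    exact mul_le_mul_of_nonneg_right (tau_antitone hS (Nat.sub_le _ _)) (hS.sigma_nonneg _)

theorem MeanEq.shift {σ τ : ℕ → ℝ} (hS : IsRegularNorlund σ τ) {u : ℕ → ℕ → ℝ} {C : ℝ}
    (hC : ∀ k j, |u k j| ≤ C)
    (h : ∀ d, MeanEq (norlundWeight σ τ) (fun k j => u (k + d) j) u) (d : ℤ) :
    MeanEq (norlundWeight σ τ) (fun k j => zext (fun l => u l j) ((k : ℤ) + d)) u := by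
  rcases le_or_gt 0 d with hd | hd
  · lift d to ℕ using hd
    exact h d
  · obtain ⟨e, rfl⟩ : ∃ e : ℕ, d = -(e : ℤ) := ⟨d.natAbs, by omega⟩
    convert (h e).shift_down hS hC using 3 with k j
    split_ifs with hk
    · rw [zext_of_neg _ (by omega)]
    · rw [show (k : ℤ) + -(e : ℤ) = ((k - e : ℕ) : ℤ) by omega, zext_natCast]

/-! ### The symbol of a Jacobi matrix with constant coefficients -/

/-- The matrix elements `(J ^ m)_{k, k + d}` of the two-sided Jacobi matrix with constant
coefficients `a` and `b`, that is, the coefficient of `z ^ d` in `(b z + a + b / z) ^ m`. -/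
def symb : ℕ → ℤ → ℝ → ℝ → ℝ
  | 0, d, _, _ => if d = 0 then 1 else 0
  | m + 1, d, a, b => b * symb m (d + 1) a b + a * symb m d a b + b * symb m (d - 1) a b

/-- `symb m d` is a combination of the monomials `a ^ i * b ^ j` with `j ≡ d` modulo `2`. For
`d = 0` only even powers of `b` occur, so that only `Sig la lb` with `lb` even enter the limit. -/
theorem symb_mem_span (m : ℕ) (d : ℤ) : symb m d ∈
    Submodule.span ℝ {f : ℝ → ℝ → ℝ | ∃ i j : ℕ, Even (j + d) ∧ f = fun a b => a ^ i * b ^ j} := by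
  have mulA : ∀ {d : ℤ} {f : ℝ → ℝ → ℝ}, f ∈ Submodule.span ℝ {f : ℝ → ℝ → ℝ |
      ∃ i j : ℕ, Even (j + d) ∧ f = fun a b => a ^ i * b ^ j} →
      (fun a b => a * f a b) ∈ Submodule.span ℝ {f : ℝ → ℝ → ℝ |
      ∃ i j : ℕ, Even (j + d) ∧ f = fun a b => a ^ i * b ^ j} := by
    intro d f hf
    induction hf using Submodule.span_induction with
    | mem f hf =>
      obtain ⟨i, j, hj, rfl⟩ := hf
      exact Submodule.subset_span ⟨i + 1, j, hj, by ext; ring⟩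
    | zero =>
      convert Submodule.zero_mem _ using 1
      ext; simp
    | add f g _ _ hf hg =>
      convert Submodule.add_mem _ hf hg using 1
      ext; simp [mul_add]
    | smul c f _ hf =>
      convert Submodule.smul_mem _ c hf using 1
      ext; simp [mul_left_comm]
  have mulB : ∀ {d e : ℤ} {f : ℝ → ℝ → ℝ}, Odd (e - d) → f ∈ Submodule.span ℝ {f : ℝ → ℝ → ℝ |
      ∃ i j : ℕ, Even (j + d) ∧ f = fun a b => a ^ i * b ^ j} →
      (fun a b => b * f a b) ∈ Submodule.span ℝ {f : ℝ → ℝ → ℝ |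
      ∃ i j : ℕ, Even (j + e) ∧ f = fun a b => a ^ i * b ^ j} := by
    intro d e f hde hf
    induction hf using Submodule.span_induction with
    | mem f hf =>
      obtain ⟨i, j, hj, rfl⟩ := hf
      refine Submodule.subset_span ⟨i, j + 1, ?_, by ext; ring⟩
      have := (hj.add_odd hde).add_odd odd_one
      rwa [show ((j + 1 : ℕ) : ℤ) + e = j + d + (e - d) + 1 by push_cast; ring]
    | zero =>
      convert Submodule.zero_mem _ using 1
      ext; simp
    | add f g _ _ hf hg =>
      convert Submodule.add_mem _ hf hg using 1
      ext; simp [mul_add]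
    | smul c f _ hf =>
      convert Submodule.smul_mem _ c hf using 1
      ext; simp [mul_left_comm]
  induction m generalizing d with
  | zero =>
    by_cases hd : d = 0
    · exact Submodule.subset_span ⟨0, 0, by simp [hd], by ext; simp [symb, hd]⟩
    · convert Submodule.zero_mem _ using 1
      ext; simp [symb, hd]
  | succ m ih =>
    exact Submodule.add_mem _ (Submodule.add_mem _
      (mulB (d := d + 1) (e := d) ⟨-1, by ring⟩ (ih (d + 1))) (mulA (ih d)))
      (mulB (d := d - 1) (e := d) ⟨0, by ring⟩ (ih (d - 1)))

/-- In the mean, the matrix elements near the diagonal are those of the Jacobi matrix whose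
coefficients are frozen at `a_k` and `b_k`. -/
theorem matElem_meanEq_symb {σ τ : ℕ → ℝ} (hS : IsRegularNorlund σ τ) {Sig : ℕ → ℕ → ℝ}
    {μ : ℕ → Measure ℝ} (hμ : ∀ k, IsAdmissible (μ k))
    (hM : MeanNevaiClass (norlundWeight σ τ) Sig μ) (m : ℕ) (d : ℤ) :
    MeanEq (norlundWeight σ τ) (fun k j => matElem (hμ j) m k ((k : ℤ) + d))
      (fun k j => symb m d (recA (μ j) k) (recB (μ j) k)) := by
  obtain ⟨A, hA⟩ := hM.bounded_a
  obtain ⟨B, hB⟩ := hM.bounded_b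
  have hw := hS.regular
  have sA := MeanEq.shift hS (u := fun k j => recA (μ j) k) (fun k j => hA k j) hM.shift_a
  have sB := MeanEq.shift hS (u := fun k j => recB (μ j) k) (fun k j => hB k j) hM.shift_b
  induction m generalizing d with
  | zero =>
    convert MeanEq.refl (norlundWeight σ τ) _ using 3 with k j
    rcases lt_or_ge ((k : ℤ) + d) 0 with h | h
    · rw [matElem, zext_of_neg _ h]
      simp [symb, show d ≠ 0 by omega]
    · obtain ⟨l, hl⟩ : ∃ l : ℕ, (k : ℤ) + d = l := ⟨_, (Int.toNat_of_nonneg h).symm⟩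
      rw [hl, matElem_zero, symb]
      congr 1
      rw [eq_iff_iff]
      omega
  | succ m ih =>
    have hG := fun d (k j : ℕ) => abs_matElem_le (hμ j) (hA · j) (hB · j) m k ((k : ℤ) + d)
    have t1 := (sB (d + 1)).mul hw (ih (d + 1)) (fun k j => hB k j) (hG (d + 1))
    have t2 := (sA d).mul hw (ih d) (fun k j => hA k j) (hG d)
    have t3 := (sB d).mul hw (ih (d - 1)) (fun k j => hB k j) (hG (d - 1))
    convert (t1.add hw t2).add hw t3 using 3 with k j k j
    · rw [matElem_succ, add_assoc (k : ℤ) d 1, add_sub_assoc (k : ℤ) d 1]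
    · rfl

/-- The means of the diagonal matrix elements converge, and the limit depends only on the numbers
`Sig la lb` with `lb` even. -/
theorem exists_tendsto_matElem (Sig : ℕ → ℕ → ℝ) (m : ℕ) : ∃ L : ℝ,
    ∀ (σ τ : ℕ → ℝ) (Sig' : ℕ → ℕ → ℝ) (μ : ℕ → Measure ℝ), IsRegularNorlund σ τ →
      ∀ (hμ : ∀ k, IsAdmissible (μ k)), MeanNevaiClass (norlundWeight σ τ) Sig' μ →
      (∀ la m : ℕ, Sig' la (2 * m) = Sig la (2 * m)) →
      Tendsto (fun n => ∑ k ∈ Finset.range (n + 1),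
        norlundWeight σ τ n k * matElem (hμ (n - k)) m k k) atTop (𝓝 L) := by
  have key : ∀ f ∈ Submodule.span ℝ {f : ℝ → ℝ → ℝ |
      ∃ i j : ℕ, Even ((j : ℤ) + 0) ∧ f = fun a b => a ^ i * b ^ j}, ∃ L : ℝ,
      ∀ (σ τ : ℕ → ℝ) (Sig' : ℕ → ℕ → ℝ) (μ : ℕ → Measure ℝ),
      MeanNevaiClass (norlundWeight σ τ) Sig' μ →
      (∀ la m : ℕ, Sig' la (2 * m) = Sig la (2 * m)) →
      Tendsto (fun n => ∑ k ∈ Finset.range (n + 1),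
        norlundWeight σ τ n k * f (recA (μ (n - k)) k) (recB (μ (n - k)) k)) atTop (𝓝 L) := by
    intro f hf
    induction hf using Submodule.span_induction with
    | mem f hf =>
      obtain ⟨i, j, hj, rfl⟩ := hf
      refine ⟨Sig i j, fun σ τ Sig' μ hM hS' => ?_⟩
      obtain ⟨l, rfl⟩ : ∃ l, j = 2 * l := by
        obtain ⟨r, hr⟩ := hj
        exact ⟨r.toNat, by omega⟩
      rw [← hS']
      exact hM.moments i (2 * l)
    | zero => exact ⟨0, fun σ τ Sig' μ _ _ => by simp⟩
    | add f g _ _ hf hg =>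
      obtain ⟨L, hL⟩ := hf
      obtain ⟨L', hL'⟩ := hg
      refine ⟨L + L', fun σ τ Sig' μ hM hS' => ?_⟩
      refine ((hL σ τ Sig' μ hM hS').add (hL' σ τ Sig' μ hM hS')).congr fun n => ?_
      rw [← Finset.sum_add_distrib]
      exact Finset.sum_congr rfl fun k _ => by simp [mul_add]
    | smul c f _ hf =>
      obtain ⟨L, hL⟩ := hf
      refine ⟨c * L, fun σ τ Sig' μ hM hS' => ?_⟩
      refine ((hL σ τ Sig' μ hM hS').const_mul c).congr fun n => ?_
      rw [Finset.mul_sum]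
      exact Finset.sum_congr rfl fun k _ => by simp [mul_left_comm]
  obtain ⟨L, hL⟩ := key _ (symb_mem_span m 0)
  refine ⟨L, fun σ τ Sig' μ hS hμ hM hS' => ?_⟩
  have h := (matElem_meanEq_symb hS hμ hM m 0).tendsto hS.regular (hL σ τ Sig' μ hM hS')
  simpa using h

/-! ### Weak limits of measures on a fixed compact interval -/

/-- Moment bounds `∫ x ^ (2 m) ≤ C R ^ (2 m)` confine a finite measure to `[-R, R]`. -/
theorem measure_compl_Icc_eq_zero_of_moments {η : Measure ℝ} [IsFiniteMeasure η] {R C : ℝ}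
    (hR : 0 ≤ R) (hint : ∀ m : ℕ, Integrable (fun x => x ^ (2 * m)) η)
    (hle : ∀ m : ℕ, ∫ x, x ^ (2 * m) ∂η ≤ C * R ^ (2 * m)) :
    η (Set.Icc (-R) R)ᶜ = 0 := by
  have h1 : ∀ s, R < s → η {x | s ≤ |x|} = 0 := by
    intro s hs
    have hs0 : 0 < s := hR.trans_lt hs
    have h2 : ∀ m : ℕ, η.real {x | s ≤ |x|} ≤ C * ((R / s) ^ 2) ^ m := by
      intro m
      have h3 := mul_meas_ge_le_integral_of_nonneg (μ := η) (f := fun x : ℝ => x ^ (2 * m))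
        (Eventually.of_forall fun x => (even_two_mul m).pow_nonneg x) (hint m) (s ^ (2 * m))
      have h4 : η.real {x | s ≤ |x|} ≤ η.real {x | s ^ (2 * m) ≤ x ^ (2 * m)} := by
        refine measureReal_mono fun x hx => ?_
        simp only [Set.mem_ofPred_eq] at hx ⊢
        rw [← (even_two_mul m).pow_abs x]
        exact pow_le_pow_left₀ hs0.le hx _
      have h5 : s ^ (2 * m) * η.real {x | s ≤ |x|} ≤ C * R ^ (2 * m) :=
        (mul_le_mul_of_nonneg_left h4 (by positivity)).trans (h3.trans (hle m))
      rw [← pow_mul, div_pow, mul_div_assoc', le_div_iff₀ (by positivity), mul_comm]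
      exact h5
    have h6 : Tendsto (fun m : ℕ => C * ((R / s) ^ 2) ^ m) atTop (𝓝 (C * 0)) := by
      refine (tendsto_pow_atTop_nhds_zero_of_lt_one (by positivity) ?_).const_mul C
      rw [sq_lt_one_iff₀ (by positivity), div_lt_one hs0]
      exact hs
    rw [mul_zero] at h6
    have h7 := ge_of_tendsto' h6 h2
    rw [← measureReal_eq_zero_iff]
    exact le_antisymm h7 measureReal_nonneg
  have h8 : (Set.Icc (-R) R)ᶜ ⊆ ⋃ n : ℕ, {x : ℝ | R + 1 / ((n : ℝ) + 1) ≤ |x|} := by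
    intro x hx
    rw [Set.mem_compl_iff, Set.mem_Icc, ← abs_le, not_le] at hx
    obtain ⟨n, hn⟩ := exists_nat_one_div_lt (sub_pos.2 hx)
    exact Set.mem_iUnion.2 ⟨n, by simp only [Set.mem_ofPred_eq]; linarith⟩
  refine measure_mono_null h8 (measure_iUnion_null fun n => h1 _ ?_)
  have : (0 : ℝ) < 1 / ((n : ℝ) + 1) := by positivity
  linarith

theorem ae_mem_Icc {η : Measure ℝ} {c d : ℝ} (h : η (Set.Icc c d)ᶜ = 0) :
    ∀ᵐ x ∂η, x ∈ Set.Icc c d := h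

theorem tendsto_integral_of_moments {ι : Type*} {l : Filter ι} {m : ι → Measure ℝ} {ρ : Measure ℝ}
    [∀ n, IsProbabilityMeasure (m n)] [IsProbabilityMeasure ρ] {R : ℝ}
    (hm : ∀ n, m n (Set.Icc (-R) R)ᶜ = 0) (hρ : ρ (Set.Icc (-R) R)ᶜ = 0)
    (hmom : ∀ j : ℕ, Tendsto (fun n => ∫ x, x ^ j ∂(m n)) l (𝓝 (∫ x, x ^ j ∂ρ)))
    {f : ℝ → ℝ} (hf : Continuous f) :
    Tendsto (fun n => ∫ x, f x ∂(m n)) l (𝓝 (∫ x, f x ∂ρ)) := by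
  have hpoly : ∀ p : ℝ[X], Tendsto (fun n => ∫ x, p.eval x ∂(m n)) l (𝓝 (∫ x, p.eval x ∂ρ)) := by
    intro p
    have h1 : ∀ η : Measure ℝ, IsProbabilityMeasure η → η (Set.Icc (-R) R)ᶜ = 0 →
        ∫ x, p.eval x ∂η = ∑ i ∈ Finset.range (p.natDegree + 1), p.coeff i * ∫ x, x ^ i ∂η := by
      intro η _ hη
      simp only [eval_eq_sum_range]
      rw [integral_finsetSum _ fun i _ => integrable_of_measure_compl_Icc hη (by fun_prop)]
      simp only [integral_const_mul]
    rw [h1 ρ inferInstance hρ]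
    refine (tendsto_finsetSum _ fun i _ => (hmom i).const_mul (p.coeff i)).congr fun n => ?_
    rw [h1 (m n) inferInstance (hm n)]
  rw [Metric.tendsto_nhds]
  intro ε hε
  obtain ⟨p, hp⟩ := exists_polynomial_near_of_continuousOn (-R) R f hf.continuousOn (ε / 3)
    (by positivity)
  have happ : ∀ η : Measure ℝ, IsProbabilityMeasure η → η (Set.Icc (-R) R)ᶜ = 0 →
      |∫ x, p.eval x ∂η - ∫ x, f x ∂η| ≤ ε / 3 := by
    intro η _ hη
    rw [← integral_sub (integrable_of_measure_compl_Icc hη p.continuous)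
      (integrable_of_measure_compl_Icc hη hf)]
    have := norm_integral_le_of_norm_le_const (μ := η) (f := fun x => p.eval x - f x) (C := ε / 3)
      ((ae_mem_Icc hη).mono fun x hx => (hp x hx).le)
    simpa using this
  filter_upwards [(Metric.tendsto_nhds.1 (hpoly p)) (ε / 3) (by positivity)] with n hn
  have h1 := abs_le.1 (happ (m n) inferInstance (hm n))
  have h2 := abs_le.1 (happ ρ inferInstance hρ)
  rw [Real.dist_eq, abs_lt] at hn ⊢
  constructor <;> linarith [h1.1, h1.2, h2.1, h2.2, hn.1, hn.2]

/-- The continuous function `f` frozen outside `[-R, R]`, as a bounded continuous function. -/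
def clip {R : ℝ} (hR : 0 ≤ R) {f : ℝ → ℝ} (hf : Continuous f) : BoundedContinuousFunction ℝ ℝ :=
  (BoundedContinuousFunction.mkOfCompact
    (⟨fun x => f x.1, hf.comp continuous_subtype_val⟩ : C(Set.Icc (-R) R, ℝ))).compContinuous
    ⟨Set.projIcc (-R) R (by linarith), continuous_projIcc⟩

theorem clip_of_mem {R : ℝ} (hR : 0 ≤ R) {f : ℝ → ℝ} (hf : Continuous f) {x : ℝ}
    (hx : x ∈ Set.Icc (-R) R) : clip hR hf x = f x := by
  simp [clip, Set.projIcc_of_mem _ hx]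

theorem integral_clip {R : ℝ} (hR : 0 ≤ R) {f : ℝ → ℝ} (hf : Continuous f) {η : Measure ℝ}
    (hη : η (Set.Icc (-R) R)ᶜ = 0) : ∫ x, clip hR hf x ∂η = ∫ x, f x ∂η :=
  integral_congr_ae ((ae_mem_Icc hη).mono fun _ hx => clip_of_mem hR hf hx)

/-- Probability measures on `[-R, R]` with convergent moments have a limit. -/
theorem exists_limit_of_moments {m : ℕ → Measure ℝ} [∀ n, IsProbabilityMeasure (m n)] {R : ℝ}
    (hR : 0 ≤ R) (hm : ∀ n, m n (Set.Icc (-R) R)ᶜ = 0) {L : ℕ → ℝ}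
    (hmom : ∀ j : ℕ, Tendsto (fun n => ∫ x, x ^ j ∂(m n)) atTop (𝓝 (L j))) :
    ∃ ρ : ProbabilityMeasure ℝ, (ρ : Measure ℝ) (Set.Icc (-R) R)ᶜ = 0 ∧
      ∀ j, ∫ x, x ^ j ∂(ρ : Measure ℝ) = L j := by
  set m' : ℕ → ProbabilityMeasure ℝ := fun n => ⟨m n, inferInstance⟩ with hm'
  have htight : IsTightMeasureSet {x : Measure ℝ | ∃ μ ∈ Set.range m', (μ : Measure ℝ) = x} := by
    rw [isTightMeasureSet_iff_exists_isCompact_measure_compl_le]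
    intro ε _
    refine ⟨Set.Icc (-R) R, isCompact_Icc, ?_⟩
    rintro _ ⟨_, ⟨n, rfl⟩, rfl⟩
    exact (hm n).le.trans zero_le
  have hcomp := isCompact_closure_of_isTightMeasureSet htight
  obtain ⟨ρ, -, hρ⟩ := hcomp.ultrafilter_le_nhds' ((hyperfilter ℕ).map m')
    (Filter.mem_map.2 (Filter.univ_mem' fun n => subset_closure ⟨n, rfl⟩))
  have hU : ((hyperfilter ℕ : Ultrafilter ℕ) : Filter ℕ) ≤ atTop := Nat.hyperfilter_le_atTop
  have ht : Tendsto m' (hyperfilter ℕ : Filter ℕ) (𝓝 ρ) := hρ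
  rw [ProbabilityMeasure.tendsto_iff_forall_integral_tendsto] at ht
  -- the support passes to the limit: test against the distance to `[-R, R]`, cut off at `1`
  have hsupp : (ρ : Measure ℝ) (Set.Icc (-R) R)ᶜ = 0 := by
    let g : BoundedContinuousFunction ℝ ℝ := BoundedContinuousFunction.ofNormedAddCommGroup
      (fun x => min 1 (max 0 (|x| - R))) (by fun_prop) 1 fun x => by
        rw [Real.norm_eq_abs, abs_of_nonneg (by positivity)]
        exact min_le_left _ _
    have hg0 : 0 ≤ (g : ℝ → ℝ) := fun x => by
      change 0 ≤ min 1 (max 0 (|x| - R)); positivity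
    have h1 : ∀ n, ∫ x, g x ∂(m n) = 0 := by
      intro n
      rw [integral_eq_zero_iff_of_nonneg hg0 (g.integrable _)]
      refine (ae_mem_Icc (hm n)).mono fun x hx => ?_
      change min 1 (max 0 (|x| - R)) = 0
      rw [max_eq_left (by linarith [abs_le.2 hx]), min_eq_right zero_le_one]
    have h2 : ∫ x, g x ∂(ρ : Measure ℝ) = 0 := by
      refine tendsto_nhds_unique (ht g) ?_
      have : (fun n => ∫ x, g x ∂(m' n : Measure ℝ)) = fun _ => 0 := funext h1
      rw [this]
      exact tendsto_const_nhds
    rw [integral_eq_zero_iff_of_nonneg hg0 (g.integrable _)] at h2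
    refine h2.mono fun x hx => ?_
    change min 1 (max 0 (|x| - R)) = 0 at hx
    rw [← abs_le]
    by_contra hlt
    have : 0 < min 1 (max 0 (|x| - R)) := lt_min one_pos (lt_max_of_lt_right (by linarith))
    exact this.ne' hx
  refine ⟨ρ, hsupp, fun j => ?_⟩
  have hj : Continuous fun x : ℝ => x ^ j := by fun_prop
  have h1 := ht (clip hR hj)
  rw [integral_clip hR hj hsupp] at h1
  refine tendsto_nhds_unique h1 (((hmom j).mono_left hU).congr fun n => ?_)
  exact (integral_clip hR hj (hm n)).symm

/-- Convergence of moments on a fixed compact interval implies weak convergence. -/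
theorem convergesWeakly_of_moments {m : ℕ → Measure ℝ} (hprob : ∀ n, IsProbabilityMeasure (m n))
    {ρ : ProbabilityMeasure ℝ} {R : ℝ} (hm : ∀ n, m n (Set.Icc (-R) R)ᶜ = 0)
    (hρ : (ρ : Measure ℝ) (Set.Icc (-R) R)ᶜ = 0)
    (hmom : ∀ j : ℕ, Tendsto (fun n => ∫ x, x ^ j ∂(m n)) atTop
      (𝓝 (∫ x, x ^ j ∂(ρ : Measure ℝ)))) : ConvergesWeakly m ρ := by
  let m' : ℕ → ProbabilityMeasure ℝ := fun n => ⟨m n, hprob n⟩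
  refine ⟨m', fun n => rfl, ?_⟩
  rw [ProbabilityMeasure.tendsto_iff_forall_integral_tendsto]
  exact fun f => tendsto_integral_of_moments hm hρ hmom f.continuous

/-! ### Integrals against the mean measures -/

/-- Finite measures with bounded support, for which every continuous function is integrable. -/
structure HasBoundedSupport (η : Measure ℝ) : Prop where
  finite : IsFiniteMeasure η
  bounded : ∃ R : ℝ, η (Set.Icc (-R) R)ᶜ = 0

theorem HasBoundedSupport.integrable {η : Measure ℝ} (h : HasBoundedSupport η) {f : ℝ → ℝ}
    (hf : Continuous f) : Integrable f η := by
  obtain ⟨R, hR⟩ := h.bounded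
  have := h.finite
  exact integrable_of_measure_compl_Icc hR hf

theorem HasBoundedSupport.zero : HasBoundedSupport 0 := ⟨inferInstance, 0, by simp⟩

theorem HasBoundedSupport.add {η ξ : Measure ℝ} (h : HasBoundedSupport η)
    (h' : HasBoundedSupport ξ) : HasBoundedSupport (η + ξ) := by
  obtain ⟨R, hR⟩ := h.bounded
  obtain ⟨R', hR'⟩ := h'.bounded
  have := h.finite
  have := h'.finite
  refine ⟨inferInstance, max R R', ?_⟩
  rw [Measure.add_apply, add_eq_zero]
  constructor
  · refine measure_mono_null (Set.compl_subset_compl.2 (Set.Icc_subset_Icc ?_ ?_)) hR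
    · exact neg_le_neg (le_max_left _ _)
    · exact le_max_left _ _
  · refine measure_mono_null (Set.compl_subset_compl.2 (Set.Icc_subset_Icc ?_ ?_)) hR'
    · exact neg_le_neg (le_max_right _ _)
    · exact le_max_right _ _

theorem HasBoundedSupport.sum {ι : Type*} (s : Finset ι) {η : ι → Measure ℝ}
    (h : ∀ i ∈ s, HasBoundedSupport (η i)) : HasBoundedSupport (∑ i ∈ s, η i) :=
  Finset.sum_induction _ _ (fun _ _ => HasBoundedSupport.add) HasBoundedSupport.zero h

theorem HasBoundedSupport.ofReal_smul {η : Measure ℝ} (h : HasBoundedSupport η) (c : ℝ) :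
    HasBoundedSupport (ENNReal.ofReal c • η) := by
  obtain ⟨R, hR⟩ := h.bounded
  have := h.finite
  exact ⟨Measure.smul_finite η ENNReal.ofReal_ne_top, R, by simp [hR]⟩

theorem HasBoundedSupport.dirac (x : ℝ) : HasBoundedSupport (Measure.dirac x) := by
  refine ⟨inferInstance, |x|, ?_⟩
  rw [Measure.dirac_apply' _ measurableSet_Icc.compl]
  simp [neg_abs_le, le_abs_self]

theorem HasBoundedSupport.sum_dirac (s : Multiset ℝ) :
    HasBoundedSupport (s.map (fun x => Measure.dirac x)).sum := by
  induction s using Multiset.induction_on with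
  | empty => simpa using HasBoundedSupport.zero
  | cons a s ih =>
    rw [Multiset.map_cons, Multiset.sum_cons]
    exact (HasBoundedSupport.dirac a).add ih

theorem IsAdmissible.hasBoundedSupport_withDensity {μ : Measure ℝ} (hμ : IsAdmissible μ)
    {g : ℝ → ℝ} (hg : Continuous g) :
    HasBoundedSupport (μ.withDensity fun x => ENNReal.ofReal (g x)) := by
  obtain ⟨c, d, hcd⟩ := hμ.bounded
  refine ⟨isFiniteMeasure_withDensity_ofReal (hμ.integrable hg).2, max |c| |d|, ?_⟩
  refine withDensity_absolutelyContinuous _ _ (measure_mono_null ?_ hcd)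
  refine Set.compl_subset_compl.2 (Set.Icc_subset_Icc ?_ ?_)
  · exact (neg_le_neg (le_max_left _ _)).trans (neg_abs_le c)
  · exact (le_abs_self d).trans (le_max_right _ _)

theorem integral_sum_dirac (s : Multiset ℝ) {f : ℝ → ℝ} (hf : Continuous f) :
    ∫ x, f x ∂(s.map (fun x => Measure.dirac x)).sum = (s.map f).sum := by
  induction s using Multiset.induction_on with
  | empty => simp
  | cons a s ih =>
    simp only [Multiset.map_cons, Multiset.sum_cons]
    rw [integral_add_measure ((HasBoundedSupport.dirac a).integrable hf)
      ((HasBoundedSupport.sum_dirac s).integrable hf), ih, integral_dirac]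

theorem integral_withDensity_ofReal {μ : Measure ℝ} {f g : ℝ → ℝ} (hg : Continuous g)
    (h0 : ∀ x, 0 ≤ g x) :
    ∫ x, f x ∂(μ.withDensity fun x => ENNReal.ofReal (g x)) = ∫ x, f x * g x ∂μ := by
  rw [integral_withDensity_eq_integral_toReal_smul (by fun_prop) (by simp)]
  simp only [ENNReal.toReal_ofReal (h0 _), smul_eq_mul, mul_comm]

theorem integral_sum_smul {ι : Type*} (s : Finset ι) {c : ι → ℝ} (hc : ∀ i ∈ s, 0 ≤ c i)
    {η : ι → Measure ℝ} (h : ∀ i ∈ s, HasBoundedSupport (η i)) {f : ℝ → ℝ} (hf : Continuous f) :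
    ∫ x, f x ∂(∑ i ∈ s, ENNReal.ofReal (c i) • η i) = ∑ i ∈ s, c i * ∫ x, f x ∂(η i) := by
  rw [integral_finsetSum_measure fun i hi => ((h i hi).ofReal_smul (c i)).integrable hf]
  refine Finset.sum_congr rfl fun i hi => ?_
  rw [integral_smul_measure, ENNReal.toReal_ofReal (hc i hi), smul_eq_mul]

@[fun_prop]
theorem continuous_cdKernel (μ : Measure ℝ) (n : ℕ) : Continuous fun x => cdKernel μ n x x := by
  unfold cdKernel
  fun_prop

theorem cdKernel_self_nonneg (μ : Measure ℝ) (n : ℕ) (x : ℝ) : 0 ≤ cdKernel μ n x x :=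
  Finset.sum_nonneg fun _ _ => mul_self_nonneg _

theorem hasBoundedSupport_meanMeasure (w : ℕ → ℕ → ℝ) {μ : ℕ → Measure ℝ}
    (hμ : ∀ k, IsAdmissible (μ k)) (n : ℕ) : HasBoundedSupport (meanMeasure w μ n) :=
  HasBoundedSupport.sum _ fun _ _ =>
    ((hμ _).hasBoundedSupport_withDensity (by fun_prop)).ofReal_smul _

theorem hasBoundedSupport_cdMeasure (σ τ : ℕ → ℝ) {μ : ℕ → Measure ℝ}
    (hμ : ∀ k, IsAdmissible (μ k)) (n : ℕ) : HasBoundedSupport (cdMeasure σ τ μ n) :=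
  (HasBoundedSupport.sum _ fun _ _ =>
    ((hμ _).hasBoundedSupport_withDensity (by fun_prop)).ofReal_smul _).ofReal_smul _

theorem hasBoundedSupport_zeroMeasure (σ τ : ℕ → ℝ) (μ : ℕ → Measure ℝ) (n : ℕ) :
    HasBoundedSupport (zeroMeasure σ τ μ n) :=
  (HasBoundedSupport.sum _ fun _ _ =>
    (HasBoundedSupport.sum_dirac _).ofReal_smul _).ofReal_smul _

theorem integral_meanMeasure {w : ℕ → ℕ → ℝ} (hw : IsRegular w) {μ : ℕ → Measure ℝ}
    (hμ : ∀ k, IsAdmissible (μ k)) (n : ℕ) {f : ℝ → ℝ} (hf : Continuous f) :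
    ∫ x, f x ∂(meanMeasure w μ n) = ∑ k ∈ Finset.range (n + 1),
      w n k * ∫ x, f x * (orthPoly (μ (n - k)) k).eval x ^ 2 ∂(μ (n - k)) := by
  rw [meanMeasure, integral_sum_smul _ (fun k hk => hw.nonneg n k (by simp at hk; omega))
    (fun k _ => (hμ _).hasBoundedSupport_withDensity (by fun_prop)) hf]
  refine Finset.sum_congr rfl fun k _ => ?_
  rw [integral_withDensity_ofReal (by fun_prop) fun x => sq_nonneg _]

theorem normConst_nonneg {σ τ : ℕ → ℝ} (hS : IsRegularNorlund σ τ) (n : ℕ) :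
    0 ≤ normConst τ n :=
  mul_nonneg (hS.tau_nonneg n) (Finset.sum_nonneg fun k _ => one_div_nonneg.2 (hS.tau_nonneg k))

theorem integral_cdMeasure {σ τ : ℕ → ℝ} (hS : IsRegularNorlund σ τ) {μ : ℕ → Measure ℝ}
    (hμ : ∀ k, IsAdmissible (μ k)) (n : ℕ) {f : ℝ → ℝ} (hf : Continuous f) :
    ∫ x, f x ∂(cdMeasure σ τ μ n) = 1 / normConst τ n * ∑ k ∈ Finset.range (n + 1),
      norlundWeight σ τ n k * ∫ x, f x * cdKernel (μ (n - k)) k x x ∂(μ (n - k)) := by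
  rw [cdMeasure, integral_smul_measure,
    ENNReal.toReal_ofReal (one_div_nonneg.2 (normConst_nonneg hS n)), smul_eq_mul,
    integral_sum_smul _ (fun k hk => hS.regular.nonneg n k (by simp at hk; omega))
    (fun k _ => (hμ _).hasBoundedSupport_withDensity (by fun_prop)) hf]
  congr 1
  refine Finset.sum_congr rfl fun k _ => ?_
  rw [integral_withDensity_ofReal (by fun_prop) fun x => cdKernel_self_nonneg _ _ x]

theorem integral_zeroMeasure {σ τ : ℕ → ℝ} (hS : IsRegularNorlund σ τ) (μ : ℕ → Measure ℝ)
    (n : ℕ) {f : ℝ → ℝ} (hf : Continuous f) :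
    ∫ x, f x ∂(zeroMeasure σ τ μ n) = 1 / normConst τ n * ∑ k ∈ Finset.range (n + 1),
      norlundWeight σ τ n k * ((orthPoly (μ (n - k)) (k + 1)).roots.map f).sum := by
  rw [zeroMeasure, integral_smul_measure,
    ENNReal.toReal_ofReal (one_div_nonneg.2 (normConst_nonneg hS n)), smul_eq_mul,
    integral_sum_smul _ (fun k hk => hS.regular.nonneg n k (by simp at hk; omega))
    (fun k _ => HasBoundedSupport.sum_dirac _) hf]
  simp only [integral_sum_dirac _ hf]

theorem integral_pow_mul_sq {μ : Measure ℝ} (hμ : IsAdmissible μ) (m k : ℕ) :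
    ∫ x, x ^ m * (orthPoly μ k).eval x ^ 2 ∂μ = matElem hμ m k k := by
  simp [matElem, intPoly_apply, pow_two, mul_assoc]

theorem integral_pow_mul_cdKernel {μ : Measure ℝ} (hμ : IsAdmissible μ) (m k : ℕ) :
    ∫ x, x ^ m * cdKernel μ k x x ∂μ = ∑ l ∈ Finset.range (k + 1), matElem hμ m l l := by
  simp only [cdKernel, Finset.mul_sum]
  rw [integral_finsetSum _ fun l _ => hμ.integrable (by fun_prop)]
  refine Finset.sum_congr rfl fun l _ => ?_
  rw [← integral_pow_mul_sq]
  simp only [pow_two]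

/-! ### The Christoffel–Darboux means as weighted averages -/

/-- Summation along antidiagonals: the Christoffel–Darboux mean of an array is the average, with
weights `1 / τ_j`, of its Nörlund means. -/
theorem cdMean_eq {σ τ : ℕ → ℝ} (hS : IsRegularNorlund σ τ) (g : ℕ → ℕ → ℝ) (n : ℕ) :
    1 / normConst τ n * ∑ k ∈ Finset.range (n + 1), norlundWeight σ τ n k *
      ∑ l ∈ Finset.range (k + 1), g l (n - k) =
    (∑ j ∈ Finset.range (n + 1), 1 / τ j)⁻¹ * ∑ j ∈ Finset.range (n + 1), 1 / τ j *
      ∑ k ∈ Finset.range (j + 1), norlundWeight σ τ j k * g k (j - k) := by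
  have h1 : ∑ k ∈ Finset.range (n + 1), norlundWeight σ τ n k *
      ∑ l ∈ Finset.range (k + 1), g l (n - k) =
      τ n * ∑ k ∈ Finset.range (n + 1), ∑ l ∈ Finset.range (k + 1), σ (n - k) * g l (n - k) := by
    simp only [norlundWeight, Finset.mul_sum, mul_assoc]
  have h2 : ∑ j ∈ Finset.range (n + 1), 1 / τ j *
      ∑ k ∈ Finset.range (j + 1), norlundWeight σ τ j k * g k (j - k) =
      ∑ j ∈ Finset.range (n + 1), ∑ k ∈ Finset.range (j + 1), σ (j - k) * g k (j - k) := by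
    refine Finset.sum_congr rfl fun j _ => ?_
    rw [Finset.mul_sum]
    refine Finset.sum_congr rfl fun k _ => ?_
    have := (tau_pos hS j).ne'
    rw [norlundWeight]
    field_simp
  -- the involution `(k, l) ↦ (n - k + l, l)` of the triangle `l ≤ k ≤ n`
  have h3 : ∑ k ∈ Finset.range (n + 1), ∑ l ∈ Finset.range (k + 1), σ (n - k) * g l (n - k) =
      ∑ j ∈ Finset.range (n + 1), ∑ k ∈ Finset.range (j + 1), σ (j - k) * g k (j - k) := by
    rw [Finset.sum_sigma', Finset.sum_sigma']
    refine Finset.sum_nbij' (fun p => ⟨n - p.1 + p.2, p.2⟩) (fun p => ⟨n - p.1 + p.2, p.2⟩)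
      ?_ ?_ ?_ ?_ ?_
    · rintro ⟨k, l⟩ h
      simp only [Finset.mem_sigma, Finset.mem_range] at h ⊢
      omega
    · rintro ⟨k, l⟩ h
      simp only [Finset.mem_sigma, Finset.mem_range] at h ⊢
      omega
    · rintro ⟨k, l⟩ h
      simp only [Finset.mem_sigma, Finset.mem_range] at h
      simp only [Sigma.mk.injEq, heq_eq_eq, and_true]
      omega
    · rintro ⟨k, l⟩ h
      simp only [Finset.mem_sigma, Finset.mem_range] at h
      simp only [Sigma.mk.injEq, heq_eq_eq, and_true]
      omega
    · rintro ⟨k, l⟩ h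
      simp only [Nat.add_sub_cancel]
  have := (tau_pos hS n).ne'
  rw [h1, h2, h3, normConst, one_div, mul_inv, mul_assoc, mul_left_comm, ← mul_assoc (τ n)⁻¹,
    inv_mul_cancel₀ this, one_mul]

theorem sum_one_div_tau_pos {σ τ : ℕ → ℝ} (hS : IsRegularNorlund σ τ) (n : ℕ) :
    0 < ∑ j ∈ Finset.range (n + 1), 1 / τ j :=
  Finset.sum_pos (fun j _ => one_div_pos.2 (tau_pos hS j)) (by simp)

theorem cdMean_one {σ τ : ℕ → ℝ} (hS : IsRegularNorlund σ τ) (n : ℕ) :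
    1 / normConst τ n * ∑ k ∈ Finset.range (n + 1), norlundWeight σ τ n k * ((k : ℝ) + 1) = 1 := by
  have h := cdMean_eq hS (fun _ _ => 1) n
  simp only [mul_one, hS.regular.sum_eq_one, Finset.sum_const, Finset.card_range, nsmul_eq_mul] at h
  rw [inv_mul_cancel₀ (sum_one_div_tau_pos hS n).ne'] at h
  exact_mod_cast h

/-- Averages with weights `1 / τ_j` preserve limits, because `∑ 1 / τ_j` diverges. -/
theorem tendsto_cdMean {σ τ : ℕ → ℝ} (hS : IsRegularNorlund σ τ)
    (hN : Tendsto (normConst τ) atTop atTop) {g : ℕ → ℕ → ℝ} {L : ℝ}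
    (hg : Tendsto (fun n => ∑ k ∈ Finset.range (n + 1), norlundWeight σ τ n k * g k (n - k))
      atTop (𝓝 L)) :
    Tendsto (fun n => 1 / normConst τ n * ∑ k ∈ Finset.range (n + 1), norlundWeight σ τ n k *
      ∑ l ∈ Finset.range (k + 1), g l (n - k)) atTop (𝓝 L) := by
  simp only [cdMean_eq hS]
  set M : ℕ → ℝ := fun n => ∑ k ∈ Finset.range (n + 1), norlundWeight σ τ n k * g k (n - k)
  -- `∑ 1 / τ_j = N_n / τ_n` and `τ_n ≤ τ_0`
  have hT : Tendsto (fun n => ∑ j ∈ Finset.range n, 1 / τ j) atTop atTop := by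
    rw [← tendsto_add_atTop_iff_nat 1]
    refine tendsto_atTop_mono (fun n => ?_) (hN.atTop_div_const (tau_pos hS 0))
    rw [div_le_iff₀ (tau_pos hS 0), normConst, mul_comm]
    exact mul_le_mul_of_nonneg_left (tau_antitone hS (Nat.zero_le n)) (sum_one_div_tau_pos hS n).le
  have h1 : (fun j => 1 / τ j * (M j - L)) =o[atTop] fun j => 1 / τ j := by
    have : (fun j => M j - L) =o[atTop] fun _ => (1 : ℝ) := by
      rw [Asymptotics.isLittleO_one_iff]
      simpa using hg.sub_const L
    simpa using (Asymptotics.isBigO_refl (fun j => 1 / τ j) atTop).mul_isLittleO this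
  have h2 := (h1.sum_range (fun j => one_div_nonneg.2 (hS.tau_nonneg j)) hT).tendsto_div_nhds_zero
  have h3 := ((tendsto_add_atTop_iff_nat 1).2 h2).add_const L
  rw [zero_add] at h3
  refine h3.congr fun n => ?_
  have := (sum_one_div_tau_pos hS n).ne'
  simp only [mul_sub, Finset.sum_sub_distrib, ← Finset.sum_mul]
  field_simp
  ring

/-! ### Moments of the mean measures and the limit theorem -/

theorem isProbabilityMeasure_of_integral_one {η : Measure ℝ} (h : HasBoundedSupport η)
    (h1 : ∫ x, x ^ 0 ∂η = 1) : IsProbabilityMeasure η := by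
  have := h.finite
  simp only [pow_zero, integral_const, smul_eq_mul, mul_one] at h1
  exact ⟨by rw [← ofReal_measureReal, h1, ENNReal.ofReal_one]⟩

/-- The moments identify the weak limit even when the a priori interval `[-R, R]` of the measures
and the interval `[-R', R']` carrying the limit are different. -/
theorem limits_of_moments {m : ℕ → Measure ℝ} (hm : ∀ n, HasBoundedSupport (m n)) {R R' : ℝ}
    (hR : 0 ≤ R) (h1 : ∀ n, ∫ x, x ^ 0 ∂(m n) = 1)
    (hle : ∀ n j, ∫ x, x ^ j ∂(m n) ≤ R ^ j) {ρ : ProbabilityMeasure ℝ}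
    (hρ : (ρ : Measure ℝ) (Set.Icc (-R') R')ᶜ = 0)
    (hmom : ∀ j : ℕ, Tendsto (fun n => ∫ x, x ^ j ∂(m n)) atTop
      (𝓝 (∫ x, x ^ j ∂(ρ : Measure ℝ)))) :
    ConvergesWeakly m ρ ∧ ∀ f : ℝ → ℝ, Continuous f →
      Tendsto (fun n => ∫ x, f x ∂(m n)) atTop (𝓝 (∫ x, f x ∂(ρ : Measure ℝ))) := by
  have hprob := fun n => isProbabilityMeasure_of_integral_one (hm n) (h1 n)
  have hsupp : ∀ n, m n (Set.Icc (-R) R)ᶜ = 0 := fun n =>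
    measure_compl_Icc_eq_zero_of_moments (C := 1) hR
      (fun j => (hm n).integrable (by fun_prop)) (fun j => by simpa using hle n (2 * j))
  have hsub : ∀ {S T : ℝ} {η : Measure ℝ}, S ≤ T → η (Set.Icc (-S) S)ᶜ = 0 →
      η (Set.Icc (-T) T)ᶜ = 0 := fun hST h =>
    measure_mono_null (Set.compl_subset_compl.2 (Set.Icc_subset_Icc (neg_le_neg hST) hST)) h
  have hsupp' := fun n => hsub (le_max_left R R') (hsupp n)
  have hρ' := hsub (le_max_right R R') hρ
  exact ⟨convergesWeakly_of_moments hprob hsupp' hρ' hmom,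
    fun f hf => tendsto_integral_of_moments hsupp' hρ' hmom hf⟩

theorem integral_pow_meanMeasure {w : ℕ → ℕ → ℝ} (hw : IsRegular w) {μ : ℕ → Measure ℝ}
    (hμ : ∀ k, IsAdmissible (μ k)) (n m : ℕ) :
    ∫ x, x ^ m ∂(meanMeasure w μ n) =
      ∑ k ∈ Finset.range (n + 1), w n k * matElem (hμ (n - k)) m k k := by
  rw [integral_meanMeasure hw hμ n (by fun_prop)]
  simp only [integral_pow_mul_sq (hμ _)]

theorem integral_pow_cdMeasure {σ τ : ℕ → ℝ} (hS : IsRegularNorlund σ τ) {μ : ℕ → Measure ℝ}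
    (hμ : ∀ k, IsAdmissible (μ k)) (n m : ℕ) :
    ∫ x, x ^ m ∂(cdMeasure σ τ μ n) = 1 / normConst τ n * ∑ k ∈ Finset.range (n + 1),
      norlundWeight σ τ n k * ∑ l ∈ Finset.range (k + 1), matElem (hμ (n - k)) m l l := by
  rw [integral_cdMeasure hS hμ n (by fun_prop)]
  simp only [integral_pow_mul_cdKernel (hμ _)]

theorem integral_pow_zero_meanMeasure {w : ℕ → ℕ → ℝ} (hw : IsRegular w) {μ : ℕ → Measure ℝ}
    (hμ : ∀ k, IsAdmissible (μ k)) (n : ℕ) : ∫ x, x ^ 0 ∂(meanMeasure w μ n) = 1 := by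
  rw [integral_pow_meanMeasure hw hμ]
  simp only [matElem_zero, if_true, mul_one, hw.sum_eq_one]

theorem integral_pow_meanMeasure_le {w : ℕ → ℕ → ℝ} (hw : IsRegular w) {μ : ℕ → Measure ℝ}
    (hμ : ∀ k, IsAdmissible (μ k)) {A B : ℝ} (hA : ∀ n k, |recA (μ k) n| ≤ A)
    (hB : ∀ n k, |recB (μ k) n| ≤ B) (n m : ℕ) :
    ∫ x, x ^ m ∂(meanMeasure w μ n) ≤ (A + 2 * B) ^ m := by
  rw [integral_pow_meanMeasure hw hμ]
  refine (Finset.sum_le_sum fun (k : ℕ) hk => mul_le_mul_of_nonneg_left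
    ((le_abs_self _).trans
    (abs_matElem_le (hμ _) (hA · _) (hB · _) m k k)) (hw.nonneg n k
      (by simp at hk; omega))).trans ?_
  rw [← Finset.sum_mul, hw.sum_eq_one, one_mul]

/-- A Christoffel–Darboux type mean is at most `C` if its `k`-th term is at most `(k + 1) C`. -/
theorem cdMean_le {σ τ : ℕ → ℝ} (hS : IsRegularNorlund σ τ) {n : ℕ} {y : ℕ → ℝ} {C : ℝ}
    (hy : ∀ k, y k ≤ (k + 1) * C) :
    1 / normConst τ n * ∑ k ∈ Finset.range (n + 1), norlundWeight σ τ n k * y k ≤ C := by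
  calc 1 / normConst τ n * ∑ k ∈ Finset.range (n + 1), norlundWeight σ τ n k * y k
      ≤ 1 / normConst τ n * ∑ k ∈ Finset.range (n + 1),
          norlundWeight σ τ n k * ((k + 1) * C) := by
        refine mul_le_mul_of_nonneg_left (Finset.sum_le_sum fun k hk => ?_)
          (one_div_nonneg.2 (normConst_nonneg hS n))
        exact mul_le_mul_of_nonneg_left (hy k) (hS.regular.nonneg n k (by simp at hk; omega))
    _ = 1 / normConst τ n *
          (∑ k ∈ Finset.range (n + 1), norlundWeight σ τ n k * ((k : ℝ) + 1)) * C := by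
        rw [mul_assoc, Finset.sum_mul]
        simp only [mul_assoc]
    _ = C := by rw [cdMean_one hS, one_mul]

/-- The moments of the zero counting measures and of the Christoffel–Darboux measures have the
same limits, because the difference of the corresponding `k`-th terms is bounded in `k` and
`N_n → ∞`. -/
theorem tendsto_integral_pow_zeroMeasure {σ τ : ℕ → ℝ} (hS : IsRegularNorlund σ τ)
    (hN : Tendsto (normConst τ) atTop atTop) {μ : ℕ → Measure ℝ} (hμ : ∀ k, IsAdmissible (μ k))
    {A B : ℝ} (hA : ∀ n k, |recA (μ k) n| ≤ A) (hB : ∀ n k, |recB (μ k) n| ≤ B) (m : ℕ) {L : ℝ}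
    (hL : Tendsto (fun n => ∫ x, x ^ m ∂(cdMeasure σ τ μ n)) atTop (𝓝 L)) :
    Tendsto (fun n => ∫ x, x ^ m ∂(zeroMeasure σ τ μ n)) atTop (𝓝 L) := by
  have h1 : Tendsto (fun n => 1 / normConst τ n * (m * (2 * (A + 2 * B) ^ m))) atTop (𝓝 0) := by
    simpa using (tendsto_inv_atTop_zero.comp hN).mul_const (m * (2 * (A + 2 * B) ^ m))
  have h2 : Tendsto (fun n => ∫ x, x ^ m ∂(zeroMeasure σ τ μ n) -
      ∫ x, x ^ m ∂(cdMeasure σ τ μ n)) atTop (𝓝 0) := by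
    refine squeeze_zero_norm (fun n => ?_) h1
    have hnn : 0 ≤ 1 / normConst τ n := one_div_nonneg.2 (normConst_nonneg hS n)
    rw [integral_zeroMeasure hS μ n (by fun_prop), integral_pow_cdMeasure hS hμ, ← mul_sub,
      ← Finset.sum_sub_distrib, Real.norm_eq_abs, abs_mul, abs_of_nonneg hnn]
    refine mul_le_mul_of_nonneg_left ((Finset.abs_sum_le_sum_abs _ _).trans ?_) hnn
    calc _ ≤ ∑ k ∈ Finset.range (n + 1),
            norlundWeight σ τ n k * (m * (2 * (A + 2 * B) ^ m)) := by
          refine Finset.sum_le_sum fun k hk => ?_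
          have hw := hS.regular.nonneg n k (by simp at hk; omega)
          rw [← mul_sub, abs_mul, abs_of_nonneg hw]
          exact mul_le_mul_of_nonneg_left
            (abs_sum_roots_pow_sub_le (hμ _) (hA · _) (hB · _) k m) hw
      _ = _ := by rw [← Finset.sum_mul, hS.regular.sum_eq_one, one_mul]
  have h3 := h2.add hL
  rw [zero_add] at h3
  exact h3.congr fun n => by ring

end MeanWeakLimits

end

theorem mainTheorem4 (σ τ : ℕ → ℝ) (hS : MeanWeakLimits.IsRegularNorlund σ τ)
    (hN : Tendsto (MeanWeakLimits.normConst τ) atTop atTop)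
    (Sig : ℕ → ℕ → ℝ) (μ : ℕ → Measure ℝ) (hμ : ∀ k, MeanWeakLimits.IsAdmissible (μ k))
    (hM : MeanWeakLimits.MeanNevaiClass (MeanWeakLimits.norlundWeight σ τ) Sig μ) :
    ∃ ρ : ProbabilityMeasure ℝ,
      -- the equilibrium measure `ρ` has compact support
      (∃ K : Set ℝ, IsCompact K ∧ (ρ : Measure ℝ) Kᶜ = 0) ∧
      -- `ρ` is determined by the numbers `Sig la lb` with `lb` even: it is the weak limit of the
      -- squared-polynomial means of every family whose numbers agree with these
      (∀ (σ' τ' : ℕ → ℝ) (Sig' : ℕ → ℕ → ℝ) (μ' : ℕ → Measure ℝ),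
        MeanWeakLimits.IsRegularNorlund σ' τ' → (∀ k, MeanWeakLimits.IsAdmissible (μ' k)) →
        MeanWeakLimits.MeanNevaiClass (MeanWeakLimits.norlundWeight σ' τ') Sig' μ' →
        (∀ la m : ℕ, Sig' la (2 * m) = Sig la (2 * m)) →
        MeanWeakLimits.ConvergesWeakly
          (MeanWeakLimits.meanMeasure (MeanWeakLimits.norlundWeight σ' τ') μ') ρ) ∧
      -- the three weak limits
      MeanWeakLimits.ConvergesWeakly (MeanWeakLimits.zeroMeasure σ τ μ) ρ ∧
      MeanWeakLimits.ConvergesWeakly (MeanWeakLimits.cdMeasure σ τ μ) ρ ∧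
      MeanWeakLimits.ConvergesWeakly
        (MeanWeakLimits.meanMeasure (MeanWeakLimits.norlundWeight σ τ) μ) ρ ∧
      -- the limit formulas for arbitrary (also unbounded) continuous functions
      ∀ f : ℝ → ℝ, Continuous f →
        Tendsto (fun n => 1 / MeanWeakLimits.normConst τ n * ∑ k ∈ Finset.range (n + 1),
            MeanWeakLimits.norlundWeight σ τ n k *
              ((MeanWeakLimits.orthPoly (μ (n - k)) (k + 1)).roots.map f).sum)
          atTop (𝓝 (∫ x, f x ∂(ρ : Measure ℝ))) ∧
        Tendsto (fun n => 1 / MeanWeakLimits.normConst τ n * ∑ k ∈ Finset.range (n + 1),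
            MeanWeakLimits.norlundWeight σ τ n k *
              ∫ x, f x * MeanWeakLimits.cdKernel (μ (n - k)) k x x ∂(μ (n - k)))
          atTop (𝓝 (∫ x, f x ∂(ρ : Measure ℝ))) ∧
        Tendsto (fun n => ∑ k ∈ Finset.range (n + 1), MeanWeakLimits.norlundWeight σ τ n k *
              ∫ x, f x * (MeanWeakLimits.orthPoly (μ (n - k)) k).eval x ^ 2 ∂(μ (n - k)))
          atTop (𝓝 (∫ x, f x ∂(ρ : Measure ℝ))) := by
  obtain ⟨A, hA⟩ := hM.bounded_a
  obtain ⟨B, hB⟩ := hM.bounded_b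
  have hR : 0 ≤ A + 2 * B := by
    linarith [(abs_nonneg _).trans (hA 0 0), (abs_nonneg _).trans (hB 0 0)]
  have hw := hS.regular
  choose L hL using MeanWeakLimits.exists_tendsto_matElem Sig
  have hmean : ∀ j, Tendsto (fun n => ∫ x, x ^ j
      ∂(MeanWeakLimits.meanMeasure (MeanWeakLimits.norlundWeight σ τ) μ n)) atTop (𝓝 (L j)) := by
    intro j
    simp only [MeanWeakLimits.integral_pow_meanMeasure hw hμ]
    exact hL j σ τ Sig μ hS hμ hM fun _ _ => rfl
  have hcd : ∀ j, Tendsto (fun n => ∫ x, x ^ j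
      ∂(MeanWeakLimits.cdMeasure σ τ μ n)) atTop (𝓝 (L j)) := by
    intro j
    simp only [MeanWeakLimits.integral_pow_cdMeasure hS hμ]
    exact MeanWeakLimits.tendsto_cdMean hS hN (g := fun l i => MeanWeakLimits.matElem (hμ i) j l l)
      (hL j σ τ Sig μ hS hμ hM fun _ _ => rfl)
  have hzero : ∀ j, Tendsto (fun n => ∫ x, x ^ j
      ∂(MeanWeakLimits.zeroMeasure σ τ μ n)) atTop (𝓝 (L j)) := fun j =>
    MeanWeakLimits.tendsto_integral_pow_zeroMeasure hS hN hμ hA hB j (hcd j)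
  have hb := MeanWeakLimits.hasBoundedSupport_meanMeasure (MeanWeakLimits.norlundWeight σ τ) hμ
  have h1 := MeanWeakLimits.integral_pow_zero_meanMeasure hw hμ
  have hle := MeanWeakLimits.integral_pow_meanMeasure_le hw hμ hA hB
  obtain ⟨ρ, hρ, hρL⟩ : ∃ ρ : ProbabilityMeasure ℝ,
      (ρ : Measure ℝ) (Set.Icc (-(A + 2 * B)) (A + 2 * B))ᶜ = 0 ∧
      ∀ j, ∫ x, x ^ j ∂(ρ : Measure ℝ) = L j := by
    have hprob := fun n => MeanWeakLimits.isProbabilityMeasure_of_integral_one (hb n) (h1 n)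
    refine MeanWeakLimits.exists_limit_of_moments hR (fun n => ?_) hmean
    exact MeanWeakLimits.measure_compl_Icc_eq_zero_of_moments (C := 1) hR
      (fun j => (hb n).integrable (by fun_prop)) (fun j => by simpa using hle n (2 * j))
  simp only [← hρL] at hmean hcd hzero
  obtain ⟨wm, fm⟩ := MeanWeakLimits.limits_of_moments hb hR h1 hle hρ hmean
  obtain ⟨wc, fc⟩ := MeanWeakLimits.limits_of_moments
    (MeanWeakLimits.hasBoundedSupport_cdMeasure σ τ hμ) hR
    (fun n => by
      rw [MeanWeakLimits.integral_pow_cdMeasure hS hμ]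
      simpa [MeanWeakLimits.matElem_zero] using MeanWeakLimits.cdMean_one hS n)
    (fun n j => by
      rw [MeanWeakLimits.integral_pow_cdMeasure hS hμ]
      refine MeanWeakLimits.cdMean_le hS fun k => ?_
      refine (Finset.sum_le_sum fun (l : ℕ) _ => (le_abs_self _).trans
        (MeanWeakLimits.abs_matElem_le (hμ (n - k)) (hA · _) (hB · _) j l l)).trans ?_
      simp) hρ hcd
  obtain ⟨wz, fz⟩ := MeanWeakLimits.limits_of_moments
    (MeanWeakLimits.hasBoundedSupport_zeroMeasure σ τ μ) hR
    (fun n => by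
      rw [MeanWeakLimits.integral_zeroMeasure hS μ n (by fun_prop)]
      simpa [MeanWeakLimits.card_roots_orthPoly (hμ _), add_comm] using
        MeanWeakLimits.cdMean_one hS n)
    (fun n j => by
      rw [MeanWeakLimits.integral_zeroMeasure hS μ n (by fun_prop)]
      exact MeanWeakLimits.cdMean_le hS fun k =>
        MeanWeakLimits.sum_roots_pow_le (hμ _) (hA · _) (hB · _) k j) hρ hzero
  refine ⟨ρ, ⟨_, isCompact_Icc, hρ⟩, ?_, wz, wc, wm, fun f hf => ⟨?_, ?_, ?_⟩⟩
  · intro σ' τ' Sig' μ' hS' hμ' hM' hSig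
    obtain ⟨A', hA'⟩ := hM'.bounded_a
    obtain ⟨B', hB'⟩ := hM'.bounded_b
    have hR' : 0 ≤ A' + 2 * B' := by
      linarith [(abs_nonneg _).trans (hA' 0 0), (abs_nonneg _).trans (hB' 0 0)]
    refine (MeanWeakLimits.limits_of_moments
      (MeanWeakLimits.hasBoundedSupport_meanMeasure (MeanWeakLimits.norlundWeight σ' τ') hμ') hR'
      (MeanWeakLimits.integral_pow_zero_meanMeasure hS'.regular hμ')
      (MeanWeakLimits.integral_pow_meanMeasure_le hS'.regular hμ' hA' hB') hρ fun j => ?_).1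
    simp only [MeanWeakLimits.integral_pow_meanMeasure hS'.regular hμ', hρL]
    exact hL j σ' τ' Sig' μ' hS' hμ' hM' hSig
  · exact (fz f hf).congr fun n => MeanWeakLimits.integral_zeroMeasure hS μ n hf
  · exact (fc f hf).congr fun n => MeanWeakLimits.integral_cdMeasure hS hμ n hf
  · exact (fm f hf).congr fun n => MeanWeakLimits.integral_meanMeasure hw hμ n hf
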